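/- **Setting.** Consider on $[t_0,T]$, $t_0<T$, the coupled field/circuit DAE for the unknowns $(a,i_m,x,v_c)$, $x=(e,i_L,i_V)$, $$M\dot a+K(a)a-Xi_m=0,\quad X^\top\dot a=v_c,\qquad E(x)\dot x+f(t,x)=Pi_m,\quad P^\top x-v_c=0,$$ where $M$, $K(a)$ (square) and $X$ are the real matrices of a space-discrete eddy-current model, with one column of $X$ per two-terminal EM field element, and $$E(x)=\begin{pmatrix}A_CC(A_C^\top e)A_C^\top&0&0\\0&-L(i_L)&0\\0&0&0\end{pmatrix},\quad f(t,x)=\begin{pmatrix}A_Rg(A_R^\top e)+A_Li_L+A_Vi_V+q_i(t)\\A_L^\top e\\A_V^\top e-q_v(t)\end{pmatrix},\quad P=\begin{pmatrix}A_m\\0\\0\end{pmatrix}.$$ Here $A_C,A_R,A_L,A_V,A_m$ are the reduced incidence matrices (ground row omitted) of the capacitors, resistors, inductors, voltage sources and EM field elements of a finite circuit. Solutions are continuous functions for which $Ma$, $X^\top a$, $A_C^\top e$ and $i_L$ are continuously differentiable (so $M\dot a$ means $(Ma)'$, etc.). An initial value $(a_0,x_0)$ is consistent if some solution of the coupled system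 on some interval $[t_0,T']$, $t_0<T'\le T$, satisfies $a(t_0)=a_0$, $x(t_0)=x_0$. **Assumptions on the field model.** $M$ is symmetric; $\lambda M+K(a)$ is symmetric positive definite for all $\lambda>0$ and all $a$; $X$ has full column rank; $a\mapsto K(a)a$ is strongly monotone and Lipschitz continuous; and $X^\top M=0$. **Assumptions on the circuit.** $g$, $C$, $L$ are Lipschitz continuous, $g$ is strongly monotone, $C$ and $L$ are uniformly positive definite; $q_i,q_v$ are continuously differentiable; $A_V$ has full column rank and $(A_C\ A_V\ A_R\ A_L)$ has full row rank. **Theorem.** Suppose that every EM field element has a parallel CVR path, i.e. its two incident nodes (ground allowed) are connected by a path consisting only of capacitors, voltage sources and resistors. Let $(a_0,x_0)$ be a consistent initial value. Then the coupled system has exactly one solution $(a,i_m,x,v_c)$ on $[t_0,T]$ with $a(t_0)=a_0$, $x(t_0)=x_0$. Moreover, for every continuous initial guess $v_c^0$ on $[t_0,T]$, the Gauss–Seidel waveform relaxation scheme $$M\dot a^k+K(a^k)a^k-Xi_m^k=0,\quad X^\top\dot a^k=v_c^{k-1},\qquad E(x^k)\dot x^k+f(t,x^k)=Pi_m^k,\quad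 P^\top x^k-v_c^k=0,$$ $a^k(t_0)=a_0$, $x^k(t_0)=x_0$, $k=1,2,\dots$, has exactly one sequence of solutions $(a^k,i_m^k,x^k,v_c^k)$ on $[t_0,T]$, and $(a^k,i_m^k,x^k,v_c^k)\to(a,i_m,x,v_c)$ uniformly on $[t_0,T]$ as $k\to\infty$. -/

import Mathlib

open Set Filter Topology Matrix
open scoped NNReal

namespace FieldCircuit

/-! ### General notions -/

/-- Strong monotonicity of `f : ℝⁿ → ℝⁿ` (with respect to the Euclidean inner product). -/
def StronglyMonotone {n : Type*} [Fintype n] (f : (n → ℝ) → (n → ℝ)) : Prop :=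
  ∃ μ : ℝ, 0 < μ ∧ ∀ x₁ x₂ : n → ℝ,
    μ * ((x₂ - x₁) ⬝ᵥ (x₂ - x₁)) ≤ (x₂ - x₁) ⬝ᵥ (f x₂ - f x₁)

/-- Uniform positive definiteness of a state-dependent square matrix (symmetry is not required). -/
def UniformlyPosDef {n m : Type*} [Fintype m] (A : (n → ℝ) → Matrix m m ℝ) : Prop :=
  ∃ μ : ℝ, 0 < μ ∧ ∀ (x : n → ℝ) (y : m → ℝ), μ * (y ⬝ᵥ y) ≤ y ⬝ᵥ (A x *ᵥ y)

/-- Lipschitz continuity of a vector-valued function. -/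
def IsLipschitz {n m : Type*} [Fintype n] [Fintype m] (f : (n → ℝ) → (m → ℝ)) : Prop :=
  ∃ c : ℝ≥0, LipschitzWith c f

/-- Lipschitz continuity of a matrix-valued function, expressed through its entries
(in finite dimensions this is Lipschitz continuity for any matrix norm). -/
def IsLipschitzMatrix {n m : Type*} [Fintype n] (A : (n → ℝ) → Matrix m m ℝ) : Prop :=
  ∃ c : ℝ≥0, ∀ i j, LipschitzWith c (fun x => A x i j)

/-! ### The space-discrete field model -/

/-- The data of the discretised eddy current model with degrees of freedom `ι` and ports
(two-terminal EM field elements) `F`: the conductivity matrix `M`, the state-dependent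
curl-curl matrix `K` and the excitation matrix `X`. -/
structure FieldModel (ι F : Type*) where
  M : Matrix ι ι ℝ
  K : (ι → ℝ) → Matrix ι ι ℝ
  X : Matrix ι F ℝ

/-- The structural properties of the space discretisation. -/
structure FieldModel.Admissible {ι F : Type*} [Fintype ι] (fm : FieldModel ι F) : Prop where
  symm_M : fm.M.IsSymm
  pencil : ∀ (a : ι → ℝ) (lam : ℝ), 0 < lam → (lam • fm.M + fm.K a).PosDef
  fullColumnRank_X : LinearIndependent ℝ fm.X.col
  stronglyMonotone : StronglyMonotone (fun a => fm.K a *ᵥ a)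

/-! ### Circuits -/

/-- A family `B` of oriented branches between the nodes of a circuit.
`some n` is a non-ground node and `none` is the ground node. -/
structure Branches (N B : Type*) where
  tail : B → Option N
  head : B → Option N

/-- The (reduced) incidence matrix of a family of branches: the row of the ground node is left
out, a branch has entry `1` at its tail and `-1` at its head. -/
def Branches.incidence {N B : Type*} [DecidableEq N] (br : Branches N B) : Matrix N B ℝ :=
  Matrix.of fun n b =>
    (if br.tail b = some n then (1 : ℝ) else 0) - (if br.head b = some n then (1 : ℝ) else 0)

/-- The branch `b` joins the nodes `p` and `q` (in either orientation). -/
def Branches.Joins {N B : Type*} (br : Branches N B) (b : B) (p q : Option N) : Prop :=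
  (br.tail b = p ∧ br.head b = q) ∨ (br.tail b = q ∧ br.head b = p)

/-- A circuit with non-ground nodes `N`, capacitors `C`, resistors `R`, inductors `L`, voltage
sources `V` and EM field elements `F`. The current sources enter through the vector `qi t` of
source currents at the nodes. -/
structure Circuit (N C R L V F : Type*) where
  brC : Branches N C
  brR : Branches N R
  brL : Branches N L
  brV : Branches N V
  brF : Branches N F
  /-- capacitances, as a function of the capacitor voltages -/
  cap : (C → ℝ) → Matrix C C ℝ
  /-- inductances, as a function of the inductor currents -/
  ind : (L → ℝ) → Matrix L L ℝ
  /-- resistor currents, as a function of the resistor voltages -/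
  g : (R → ℝ) → (R → ℝ)
  qi : ℝ → N → ℝ
  qv : ℝ → V → ℝ

namespace Circuit

variable {N C R L V F : Type*}

section Incidence

variable [DecidableEq N] (ci : Circuit N C R L V F)

def AC : Matrix N C ℝ := ci.brC.incidence
def AR : Matrix N R ℝ := ci.brR.incidence
def AL : Matrix N L ℝ := ci.brL.incidence
def AV : Matrix N V ℝ := ci.brV.incidence
/-- Incidence matrix of the EM field elements. -/
def Am : Matrix N F ℝ := ci.brF.incidence

end Incidence

/-- The structural properties of the circuit on the time interval `[t₀, T]`. -/
structure Admissible [Fintype N] [DecidableEq N] [Fintype C] [Fintype R] [Fintype L] [Fintype V]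
    (ci : Circuit N C R L V F) (t₀ T : ℝ) : Prop where
  lipschitz_g : IsLipschitz ci.g
  lipschitz_cap : IsLipschitzMatrix ci.cap
  lipschitz_ind : IsLipschitzMatrix ci.ind
  stronglyMonotone_g : StronglyMonotone ci.g
  posDef_cap : UniformlyPosDef ci.cap
  posDef_ind : UniformlyPosDef ci.ind
  contDiff_qi : ContDiffOn ℝ 1 ci.qi (Icc t₀ T)
  contDiff_qv : ContDiffOn ℝ 1 ci.qv (Icc t₀ T)
  fullColumnRank_AV : LinearIndependent ℝ ci.AV.col
  fullRowRank : LinearIndependent ℝ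
    (Matrix.fromCols (Matrix.fromCols ci.AC ci.AV) (Matrix.fromCols ci.AR ci.AL)).row

/-- The graph on all nodes (ground included) whose edges are the pairs of distinct nodes that are
joined by a capacitor, a voltage source or a resistor. -/
def cvrGraph (ci : Circuit N C R L V F) : SimpleGraph (Option N) where
  Adj p q := p ≠ q ∧
    ((∃ b, ci.brC.Joins b p q) ∨ (∃ b, ci.brV.Joins b p q) ∨ (∃ b, ci.brR.Joins b p q))
  symm := ⟨by
    intro p q h
    simp only [Branches.Joins] at h ⊢
    refine ⟨h.1.symm, ?_⟩
    simpa only [or_comm] using h.2⟩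
  loopless := ⟨fun p h => h.1 rfl⟩

/-- The field element `m` has a parallel CVR path: a path consisting only of capacitors, voltage
sources and resistors connects its incident nodes. -/
def HasParallelCVRPath (ci : Circuit N C R L V F) (m : F) : Prop :=
  ∃ p : ci.cvrGraph.Walk (ci.brF.tail m) (ci.brF.head m), p.IsPath

end Circuit

/-! ### Solutions -/

/-- The circuit unknown `x = (e, i_L, i_V)`: node potentials, inductor currents and currents
through the voltage sources. -/
abbrev CircuitState (N L V : Type*) := (N → ℝ) × (L → ℝ) × (V → ℝ)

/-- The unknown `(a, i_m, x, v_c)` of the coupled system. -/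
abbrev State (ι F N L V : Type*) := (ι → ℝ) × (F → ℝ) × CircuitState N L V × (F → ℝ)

variable {ι F N C R L V : Type*}
  [Fintype ι] [Fintype F] [Fintype N] [DecidableEq N] [Fintype C] [Fintype R] [Fintype L]
  [Fintype V]

/-- `(a, i_m)` solves the field system `M a' + K(a) a - X i_m = 0`, `Xᵀ a' = v` on `[t₀, T]` with
input `v`. As usual for differential-algebraic equations, `a` and `i_m` are continuous and only
the components `M a` and `Xᵀ a`, whose derivatives occur, are required to be differentiable. -/
def FieldModel.IsSolution (fm : FieldModel ι F) (t₀ T : ℝ)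
    (a : ℝ → ι → ℝ) (im v : ℝ → F → ℝ) : Prop :=
  ContinuousOn a (Icc t₀ T) ∧ ContinuousOn im (Icc t₀ T) ∧
  ∃ (dMa : ℝ → ι → ℝ) (dXa : ℝ → F → ℝ),
    ContinuousOn dMa (Icc t₀ T) ∧ ContinuousOn dXa (Icc t₀ T) ∧
    ∀ t ∈ Icc t₀ T,
      HasDerivWithinAt (fun s => fm.M *ᵥ a s) (dMa t) (Icc t₀ T) t ∧
      HasDerivWithinAt (fun s => fm.Xᵀ *ᵥ a s) (dXa t) (Icc t₀ T) t ∧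
      dMa t + fm.K (a t) *ᵥ a t - fm.X *ᵥ im t = 0 ∧
      dXa t = v t

/-- `(x, v_c)` solves the circuit equations of modified nodal analysis
`E(x) x' + f(t, x) = P i_m`, `Pᵀ x - v_c = 0` on `[t₀, T]` with input `i_m`, written out for
`x = (e, i_L, i_V)`. All unknowns are continuous, and only the components `A_Cᵀ e` and `i_L`, whose
derivatives occur, are required to be continuously differentiable. -/
def Circuit.IsSolution (ci : Circuit N C R L V F) (t₀ T : ℝ)
    (x : ℝ → CircuitState N L V) (vc im : ℝ → F → ℝ) : Prop :=
  ContinuousOn x (Icc t₀ T) ∧ ContinuousOn vc (Icc t₀ T) ∧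
  ∃ (du : ℝ → C → ℝ) (dj : ℝ → L → ℝ),
    ContinuousOn du (Icc t₀ T) ∧ ContinuousOn dj (Icc t₀ T) ∧
    ∀ t ∈ Icc t₀ T,
      HasDerivWithinAt (fun s => ci.ACᵀ *ᵥ (x s).1) (du t) (Icc t₀ T) t ∧
      HasDerivWithinAt (fun s => (x s).2.1) (dj t) (Icc t₀ T) t ∧
      ci.AC *ᵥ (ci.cap (ci.ACᵀ *ᵥ (x t).1) *ᵥ du t)
          + (ci.AR *ᵥ ci.g (ci.ARᵀ *ᵥ (x t).1) + ci.AL *ᵥ (x t).2.1 + ci.AV *ᵥ (x t).2.2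
              + ci.qi t) = ci.Am *ᵥ im t ∧
      -(ci.ind (x t).2.1 *ᵥ dj t) + ci.ALᵀ *ᵥ (x t).1 = 0 ∧
      ci.AVᵀ *ᵥ (x t).1 - ci.qv t = 0 ∧
      ci.Amᵀ *ᵥ (x t).1 - vc t = 0

/-- `z = (a, i_m, x, v_c)` solves the field system with input `v` and the circuit system with the
input `i_m` on `[t₀, T]`, and satisfies the initial conditions `a(t₀) = a₀`, `x(t₀) = x₀`. -/
def SolvesWithInput (fm : FieldModel ι F) (ci : Circuit N C R L V F) (t₀ T : ℝ)
    (a₀ : ι → ℝ) (x₀ : CircuitState N L V) (v : ℝ → F → ℝ) (z : ℝ → State ι F N L V) : Prop :=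
  fm.IsSolution t₀ T (fun t => (z t).1) (fun t => (z t).2.1) v ∧
  ci.IsSolution t₀ T (fun t => (z t).2.2.1) (fun t => (z t).2.2.2) (fun t => (z t).2.1) ∧
  (z t₀).1 = a₀ ∧ (z t₀).2.2.1 = x₀

/-- `z = (a, i_m, x, v_c)` is an exact solution of the coupled field/circuit initial value problem
on `[t₀, T]`. -/
def IsExactSolution (fm : FieldModel ι F) (ci : Circuit N C R L V F) (t₀ T : ℝ)
    (a₀ : ι → ℝ) (x₀ : CircuitState N L V) (z : ℝ → State ι F N L V) : Prop :=
  SolvesWithInput fm ci t₀ T a₀ x₀ (fun t => (z t).2.2.2) z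

/-- The initial value `(a₀, x₀)` at time `t₀` is consistent: some solution of the coupled system
starts there, on a possibly very short time interval. -/
def ConsistentInitialValue (fm : FieldModel ι F) (ci : Circuit N C R L V F) (t₀ T : ℝ)
    (a₀ : ι → ℝ) (x₀ : CircuitState N L V) : Prop :=
  ∃ T' : ℝ, t₀ < T' ∧ T' ≤ T ∧ ∃ z : ℝ → State ι F N L V, IsExactSolution fm ci t₀ T' a₀ x₀ z

/-- `Z` is a sequence of Gauss-Seidel waveform relaxation iterates on `[t₀, T]` with initial guess
`v₀`. The iterate number `k ≥ 1` is `Z (k - 1)`: the first one solves the field system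
with input `v₀`, every later one with the `v_c` of its predecessor, and the circuit system is
solved with the `i_m` just computed. All iterates start from the same initial value. -/
def IsWaveformRelaxation (fm : FieldModel ι F) (ci : Circuit N C R L V F) (t₀ T : ℝ)
    (a₀ : ι → ℝ) (x₀ : CircuitState N L V) (v₀ : ℝ → F → ℝ)
    (Z : ℕ → ℝ → State ι F N L V) : Prop :=
  SolvesWithInput fm ci t₀ T a₀ x₀ v₀ (Z 0) ∧
  ∀ k : ℕ, SolvesWithInput fm ci t₀ T a₀ x₀ (fun t => (Z k t).2.2.2) (Z (k + 1))

end FieldCircuit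

/-!
The coupled system is reduced to an ordinary differential equation for its differential variables
`y = (Xᵀ a, M a, A_Cᵀ e, i_L)`, and the relaxation scheme becomes a Picard type iteration for it.

*Reduction.* All algebraic unknowns are found from equations of the form `Φ(s) ⊥ S`, `s ∈ S`, where
`S` is a subspace and `Φ` is strongly monotone and Lipschitz continuous; such equations are uniquely
solvable (`exists_galerkin`), with a stability estimate (`galerkin_norm_sub_le`) that shows how
the solution depends on the data. In the field model (`FieldModel.exists_reduction`), `S` is
`ker M ∩ ker Xᵀ` and `Xᵀ M = 0` yields the current `i_m` as a Lipschitz continuous function of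
`(Xᵀ a, M a)`, without derivatives. In the circuit (`Circuit.exists_reduction`), the node potentials
are split along voltage sources, capacitors, resistors and inductors (`NodeSplitting`), and one such
equation each gives the resistor part of `e` and the derivatives of `A_Cᵀ e` and `i_L`. The part of
`e` that only inductors see depends on the derivative of `i_L`, hence on `q_i'`: the circuit may have
index two. The CVR paths enter exactly here: this part is invisible to the field elements
(`Circuit.Am_transpose_mulVec_eq_zero`), so that neither does `i_m` enter the constraints on the
differential variables, nor is `i_m` or `v_c` ever differentiated.

*Relaxation.* One step of the scheme is thus equivalent to `y' = f(t, y, v)` with input `v` and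
output `v_c = H(t, y)` (`exists_coupled_reduction`). Neither map is globally Lipschitz
continuous, since `C(u)` and `L(j)` may be unbounded and their inverses multiply unbounded
quantities. But both are *tame* (`TameOn`): Lipschitz continuous on bounded sets and of linear
growth. The latter bounds solutions and all iterates uniformly, the former then makes the error
decay geometrically in an exponentially weighted norm (`exists_waveform_limit`).
-/

namespace FieldCircuit

/-! ### Tame vector fields -/

section Tame

variable {E G G' : Type*} [NormedAddCommGroup E] [NormedAddCommGroup G] [NormedAddCommGroup G']

/-- A time dependent map `φ` is *tame* on a set `I` of times if it is jointly continuous, Lipschitz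
on bounded sets and of linear growth, the last two uniformly in time. This is the class of right
hand sides for which initial value problems are globally solvable; global Lipschitz continuity
would be too much to ask, because products such as `C(u)⁻¹ r` are only locally Lipschitz. -/
structure TameOn (I : Set ℝ) (φ : ℝ → E → G) : Prop where
  cont : ContinuousOn (fun p : ℝ × E => φ p.1 p.2) (I ×ˢ univ)
  lip : ∀ R : ℝ, ∃ K : ℝ, 0 ≤ K ∧ ∀ t ∈ I, ∀ x y, ‖x‖ ≤ R → ‖y‖ ≤ R →
    ‖φ t x - φ t y‖ ≤ K * ‖x - y‖
  growth : ∃ c : ℝ, 0 ≤ c ∧ ∀ t ∈ I, ∀ x, ‖φ t x‖ ≤ c * (1 + ‖x‖)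

variable {I : Set ℝ} {φ ψ : ℝ → E → G}

lemma TameOn.continuousOn_comp (h : TameOn I φ) {y : ℝ → E} (hy : ContinuousOn y I) :
    ContinuousOn (fun t => φ t (y t)) I :=
  h.cont.comp (f := fun t => (t, y t)) (continuousOn_id.prodMk hy) fun _ ht => ⟨ht, mem_univ _⟩

lemma TameOn.of_continuousOn (hI : IsCompact I) {c : ℝ → G} (hc : ContinuousOn c I) :
    TameOn I (fun t (_ : E) => c t) := by
  obtain ⟨C, hC⟩ := hI.exists_bound_of_continuousOn hc
  refine ⟨hc.comp continuousOn_fst fun p hp => hp.1, fun R => ⟨0, le_rfl, by simp⟩,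
    |C|, abs_nonneg _, fun t ht x => ?_⟩
  have := hC t ht
  nlinarith [le_abs_self C, abs_nonneg C, norm_nonneg x]

lemma TameOn.lipschitz_comp {f : G → G'} {K : ℝ≥0} (hf : LipschitzWith K f) (h : TameOn I φ) :
    TameOn I (fun t x => f (φ t x)) := by
  refine ⟨hf.continuous.comp_continuousOn h.cont, fun R => ?_, ?_⟩
  · obtain ⟨k, hk, hk'⟩ := h.lip R
    refine ⟨K * k, by positivity, fun t ht x y hx hy => ?_⟩
    have h1 := hf.dist_le_mul (φ t x) (φ t y)
    rw [dist_eq_norm, dist_eq_norm] at h1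
    rw [mul_assoc]
    exact h1.trans (by gcongr; exact hk' t ht x y hx hy)
  · obtain ⟨c, hc, hc'⟩ := h.growth
    refine ⟨K * c + ‖f 0‖, by positivity, fun t ht x => ?_⟩
    have h1 := hf.dist_le_mul (φ t x) 0
    rw [dist_eq_norm, dist_eq_norm, sub_zero] at h1
    have h2 : ‖f (φ t x)‖ ≤ ‖f (φ t x) - f 0‖ + ‖f 0‖ := by
      simpa using norm_add_le (f (φ t x) - f 0) (f 0)
    have h3 : (K : ℝ) * ‖φ t x‖ ≤ K * (c * (1 + ‖x‖)) := by gcongr; exact hc' t ht x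
    nlinarith [norm_nonneg (f 0), norm_nonneg x]

lemma TameOn.prodMk {χ : ℝ → E → G'} (h : TameOn I φ) (h' : TameOn I χ) :
    TameOn I (fun t x => (φ t x, χ t x)) := by
  refine ⟨h.cont.prodMk h'.cont, fun R => ?_, ?_⟩
  · obtain ⟨k, hk, hk'⟩ := h.lip R
    obtain ⟨l, hl, hl'⟩ := h'.lip R
    refine ⟨max k l, by positivity, fun t ht x y hx hy => ?_⟩
    rw [Prod.mk_sub_mk, norm_prod_le_iff]
    exact ⟨(hk' t ht x y hx hy).trans (by gcongr; exact le_max_left _ _),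
      (hl' t ht x y hx hy).trans (by gcongr; exact le_max_right _ _)⟩
  · obtain ⟨k, hk, hk'⟩ := h.growth
    obtain ⟨l, hl, hl'⟩ := h'.growth
    refine ⟨max k l, by positivity, fun t ht x => ?_⟩
    rw [norm_prod_le_iff]
    exact ⟨(hk' t ht x).trans (by gcongr; exact le_max_left _ _),
      (hl' t ht x).trans (by gcongr; exact le_max_right _ _)⟩

lemma TameOn.exists_bound (h : TameOn I φ) (R : ℝ) :
    ∃ B : ℝ, 0 ≤ B ∧ ∀ t ∈ I, ∀ x, ‖x‖ ≤ R → ‖φ t x‖ ≤ B := by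
  obtain ⟨c, hc, hc'⟩ := h.growth
  refine ⟨c * (1 + |R|), by positivity, fun t ht x hx => (hc' t ht x).trans ?_⟩
  gcongr
  exact hx.trans (le_abs_self R)

lemma TameOn.comp {χ : ℝ → G → G'} (hχ : TameOn I χ) (h : TameOn I φ) :
    TameOn I (fun t x => χ t (φ t x)) := by
  refine ⟨hχ.cont.comp (f := fun p : ℝ × E => (p.1, φ p.1 p.2)) (continuousOn_fst.prodMk h.cont)
    fun p hp => ⟨hp.1, mem_univ _⟩, fun R => ?_, ?_⟩
  · obtain ⟨B, _, hB⟩ := h.exists_bound R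
    obtain ⟨k, hk, hk'⟩ := h.lip R
    obtain ⟨l, hl, hl'⟩ := hχ.lip B
    refine ⟨l * k, by positivity, fun t ht x y hx hy => ?_⟩
    refine (hl' t ht _ _ (hB t ht x hx) (hB t ht y hy)).trans ?_
    rw [mul_assoc]
    gcongr
    exact hk' t ht x y hx hy
  · obtain ⟨k, hk, hk'⟩ := h.growth
    obtain ⟨l, hl, hl'⟩ := hχ.growth
    refine ⟨l * (1 + k), by positivity, fun t ht x => (hl' t ht _).trans ?_⟩
    rw [mul_assoc]
    gcongr
    nlinarith [hk' t ht x, norm_nonneg x]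

variable [NormedSpace ℝ G] [NormedSpace ℝ G']

lemma TameOn.clm_comp (L : G →L[ℝ] G') (h : TameOn I φ) : TameOn I (fun t x => L (φ t x)) :=
  h.lipschitz_comp L.lipschitz

lemma TameOn.add (h : TameOn I φ) (h' : TameOn I ψ) : TameOn I (fun t x => φ t x + ψ t x) :=
  (h.prodMk h').clm_comp (ContinuousLinearMap.fst ℝ G G + ContinuousLinearMap.snd ℝ G G)

lemma TameOn.sub (h : TameOn I φ) (h' : TameOn I ψ) : TameOn I (fun t x => φ t x - ψ t x) :=
  (h.prodMk h').clm_comp (ContinuousLinearMap.fst ℝ G G - ContinuousLinearMap.snd ℝ G G)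

lemma TameOn.clm [NormedSpace ℝ E] (L : E →L[ℝ] G) : TameOn I (fun _ x => L x) := by
  refine ⟨(L.continuous.comp continuous_snd).continuousOn,
    fun R => ⟨‖L‖, norm_nonneg _, fun t _ x y _ _ => ?_⟩, ‖L‖, norm_nonneg _, fun t _ x => ?_⟩
  · rw [← map_sub]; exact L.le_opNorm _
  · nlinarith [L.le_opNorm x, norm_nonneg L]

end Tame

/-! ### Initial value problems with tame right hand side -/

section ODE

variable {E U : Type*} [NormedAddCommGroup E] [NormedSpace ℝ E]
  [NormedAddCommGroup U]

/-- `y` solves `y' = f(t, y)` on `[t₀, T]` (with one-sided derivatives at the end points) and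
`y(t₀) = y₀`. -/
def SolvesIVP (f : ℝ → E → E) (t₀ T : ℝ) (y₀ : E) (y : ℝ → E) : Prop :=
  y t₀ = y₀ ∧ ∀ t ∈ Icc t₀ T, HasDerivWithinAt y (f t (y t)) (Icc t₀ T) t

lemma SolvesIVP.continuousOn {f : ℝ → E → E} {t₀ T : ℝ} {y₀ : E} {y : ℝ → E}
    (h : SolvesIVP f t₀ T y₀ y) : ContinuousOn y (Icc t₀ T) :=
  fun t ht => (h.2 t ht).continuousWithinAt

lemma hasDerivWithinAt_Ici {y : ℝ → E} {y' : E} {t₀ T t : ℝ} (ht : t ∈ Ico t₀ T)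
    (h : HasDerivWithinAt y y' (Icc t₀ T) t) : HasDerivWithinAt y y' (Ici t) t :=
  h.mono_of_mem_nhdsWithin (mem_of_superset (Icc_mem_nhdsGE ht.2) (Icc_subset_Icc_left ht.1))

/-- A function whose derivative is too small to cross the barrier `B exp(lam (t - t₀))` stays below
it. All estimates (a priori bounds and convergence rates) are applications of this. -/
lemma norm_le_exp_barrier {y y' : ℝ → E} {t₀ T B lam : ℝ}
    (hy : ∀ t ∈ Icc t₀ T, HasDerivWithinAt y (y' t) (Icc t₀ T) t) (h₀ : ‖y t₀‖ ≤ B)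
    (hb : ∀ t ∈ Icc t₀ T, ‖y t‖ = B * Real.exp (lam * (t - t₀)) →
      ‖y' t‖ < lam * (B * Real.exp (lam * (t - t₀)))) :
    ∀ t ∈ Icc t₀ T, ‖y t‖ ≤ B * Real.exp (lam * (t - t₀)) := by
  refine image_norm_le_of_norm_deriv_right_lt_deriv_boundary
    (B' := fun t => lam * (B * Real.exp (lam * (t - t₀))))
    (fun t ht => (hy t ht).continuousWithinAt)
    (fun t ht => hasDerivWithinAt_Ici ht (hy t (Ico_subset_Icc_self ht))) (by simpa using h₀)
    (fun t => ?_) fun t ht => hb t (Ico_subset_Icc_self ht)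
  have h := ((((hasDerivAt_id t).sub_const t₀).const_mul lam).exp).const_mul B
  refine h.congr_deriv ?_
  rw [id]
  ring

/-- Tame initial value problems have at most one solution. -/
theorem SolvesIVP.eqOn {f : ℝ → E → E} {t₀ T : ℝ} {y₀ : E} {y z : ℝ → E}
    (hf : TameOn (Icc t₀ T) f) (hy : SolvesIVP f t₀ T y₀ y) (hz : SolvesIVP f t₀ T y₀ z) :
    EqOn y z (Icc t₀ T) := by
  obtain ⟨A, hA⟩ := isCompact_Icc.exists_bound_of_continuousOn hy.continuousOn
  obtain ⟨B, hB⟩ := isCompact_Icc.exists_bound_of_continuousOn hz.continuousOn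
  obtain ⟨K, hK, hK'⟩ := hf.lip (max A B)
  refine ODE_solution_unique_of_mem_Icc_right (v := f) (K := K.toNNReal)
    (s := fun _ => Metric.closedBall 0 (max A B)) (fun t ht => ?_) hy.continuousOn
    (fun t ht => hasDerivWithinAt_Ici ht (hy.2 t (Ico_subset_Icc_self ht))) (fun t ht => ?_)
    hz.continuousOn (fun t ht => hasDerivWithinAt_Ici ht (hz.2 t (Ico_subset_Icc_self ht)))
    (fun t ht => ?_) (hy.1.trans hz.1.symm)
  · refine LipschitzOnWith.of_dist_le_mul fun x hx y hy => ?_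
    rw [dist_eq_norm, dist_eq_norm, Real.coe_toNNReal K hK]
    exact hK' t (Ico_subset_Icc_self ht) x y (by simpa using hx) (by simpa using hy)
  · simpa using Or.inl (hA t (Ico_subset_Icc_self ht))
  · simpa using Or.inr (hB t (Ico_subset_Icc_self ht))

/-- The radial retraction of a normed space onto the closed ball of radius `R`. -/
noncomputable def radialRetraction (R : ℝ) (x : E) : E := (R / max R ‖x‖) • x

lemma radialRetraction_of_norm_le {R : ℝ} (hR : 0 < R) {x : E} (hx : ‖x‖ ≤ R) :
    radialRetraction R x = x := by
  simp [radialRetraction, max_eq_left hx, hR.ne']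

lemma norm_radialRetraction_le {R : ℝ} (hR : 0 < R) (x : E) :
    ‖radialRetraction R x‖ ≤ R ∧ ‖radialRetraction R x‖ ≤ ‖x‖ := by
  have hm : 0 < max R ‖x‖ := lt_max_of_lt_left hR
  rw [radialRetraction, norm_smul, Real.norm_of_nonneg (by positivity)]
  constructor
  · rw [div_mul_eq_mul_div, div_le_iff₀ hm]
    gcongr
    exact le_max_right _ _
  · refine mul_le_of_le_one_left (norm_nonneg _) ?_
    rw [div_le_one hm]
    exact le_max_left _ _

lemma norm_radialRetraction_sub_le {R : ℝ} (hR : 0 < R) (x y : E) :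
    ‖radialRetraction R x - radialRetraction R y‖ ≤ 2 * ‖x - y‖ := by
  have hx : 0 < max R ‖x‖ := lt_max_of_lt_left hR
  have hy : 0 < max R ‖y‖ := lt_max_of_lt_left hR
  have key : radialRetraction R x - radialRetraction R y =
      (R / max R ‖x‖) • (x - y) + (R / max R ‖x‖ - R / max R ‖y‖) • y := by
    simp only [radialRetraction]
    module
  have h1 : R / max R ‖x‖ ≤ 1 := (div_le_one hx).2 (le_max_left _ _)
  have h1' : 0 ≤ R / max R ‖x‖ := by positivity
  have h2 : ‖y‖ / max R ‖y‖ ≤ 1 := (div_le_one hy).2 (le_max_right _ _)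
  have h2' : 0 ≤ ‖y‖ / max R ‖y‖ := by positivity
  have h3 : |max R ‖y‖ - max R ‖x‖| ≤ ‖x - y‖ := by
    rw [max_comm R, max_comm R, norm_sub_rev]
    exact (abs_max_sub_max_le_abs _ _ _).trans (abs_norm_sub_norm_le y x)
  have h4 : (R / max R ‖x‖ - R / max R ‖y‖) * ‖y‖ =
      (R / max R ‖x‖) * (‖y‖ / max R ‖y‖) * (max R ‖y‖ - max R ‖x‖) := by
    field_simp
  rw [key]
  refine (norm_add_le _ _).trans ?_
  rw [norm_smul, norm_smul, Real.norm_of_nonneg h1', Real.norm_eq_abs]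
  have h5 : |R / max R ‖x‖ - R / max R ‖y‖| * ‖y‖ ≤ ‖x - y‖ := by
    rw [← abs_norm y, ← abs_mul, abs_norm, h4, abs_mul, abs_of_nonneg (by positivity)]
    exact (mul_le_of_le_one_left (abs_nonneg _) (mul_le_one₀ h1 h2' h2)).trans h3
  have h6 := mul_le_of_le_one_left (norm_nonneg (x - y)) h1
  linarith

/-- Tame initial value problems are globally solvable: the right hand side is truncated outside a
ball that solutions cannot leave, so that the Picard-Lindelöf theorem applies on all of `[t₀, T]`. -/
theorem exists_solvesIVP [CompleteSpace E] {f : ℝ → E → E} {t₀ T : ℝ} (hT : t₀ ≤ T)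
    (hf : TameOn (Icc t₀ T) f) (y₀ : E) : ∃ y, SolvesIVP f t₀ T y₀ y := by
  obtain ⟨c, hc, hc'⟩ := hf.growth
  set B : ℝ := ‖y₀‖ + 1 with hB
  set lam : ℝ := 2 * c + 1 with hlam
  have hB1 : 1 ≤ B := by rw [hB]; linarith [norm_nonneg y₀]
  set R : ℝ := B * Real.exp (lam * (T - t₀)) with hR
  have hRpos : 0 < R := by positivity
  obtain ⟨K, hK, hK'⟩ := hf.lip R
  have hL : 0 ≤ c * (1 + R) := by positivity
  have hpl : IsPicardLindelof (fun t x => f t (radialRetraction R x)) (tmin := t₀) (tmax := T)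
      ⟨t₀, left_mem_Icc.2 hT⟩ y₀ (c * (1 + R) * (T - t₀)).toNNReal 0 (c * (1 + R)).toNNReal
      (K * 2).toNNReal := by
    refine ⟨fun t ht => ?_, fun x _ => ?_, fun t ht x _ => ?_, ?_⟩
    · refine (LipschitzWith.of_dist_le_mul fun x y => ?_).lipschitzOnWith
      rw [dist_eq_norm, dist_eq_norm, Real.coe_toNNReal _ (by positivity), mul_assoc]
      refine (hK' t ht _ _ (norm_radialRetraction_le hRpos x).1
        (norm_radialRetraction_le hRpos y).1).trans ?_
      gcongr
      exact norm_radialRetraction_sub_le hRpos x y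
    · exact hf.continuousOn_comp continuousOn_const
    · rw [Real.coe_toNNReal _ hL]
      refine (hc' t ht _).trans ?_
      gcongr
      exact (norm_radialRetraction_le hRpos x).1
    · have : 0 ≤ T - t₀ := sub_nonneg.2 hT
      rw [Real.coe_toNNReal _ hL, Real.coe_toNNReal _ (by positivity)]
      simp [this]
  obtain ⟨y, hy₀, hy⟩ := hpl.exists_eq_forall_mem_Icc_hasDerivWithinAt₀
  simp only at hy₀
  have hbound := norm_le_exp_barrier (B := B) (lam := lam) hy (by rw [hy₀, hB]; linarith)
    fun t ht h => by
      have h1 := hc' t ht (radialRetraction R (y t))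
      have h2 := (norm_radialRetraction_le hRpos (y t)).2
      have h3 : 1 ≤ Real.exp (lam * (t - t₀)) :=
        Real.one_le_exp (mul_nonneg (by positivity) (sub_nonneg.2 ht.1))
      rw [← h]
      have h4 : 1 ≤ ‖y t‖ := by rw [h]; nlinarith
      have h5 : c * (1 + ‖radialRetraction R (y t)‖) ≤ c * (1 + ‖y t‖) := by gcongr
      rw [hlam]
      nlinarith
  refine ⟨y, hy₀, fun t ht => ?_⟩
  have h1 : ‖y t‖ ≤ R := (hbound t ht).trans (by
    rw [hR]; gcongr; exact ht.2)
  have h2 := hy t ht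
  rwa [radialRetraction_of_norm_le hRpos h1] at h2

/-! ### Waveform relaxation for ordinary differential equations -/

/-- The abstract form of the relaxation scheme: the input of `y' = F(t, y, v)` is replaced by the
output `H(t, y)` of the previous iterate. All iterates stay below a common exponential, and the
error halves in each step when it is measured against a sufficiently fast growing exponential. -/
theorem exists_waveform_limit [CompleteSpace E] {F : ℝ → E × U → E} {H : ℝ → E → U} {t₀ T : ℝ}
    (hT : t₀ ≤ T) (hF : TameOn (Icc t₀ T) F) (hH : TameOn (Icc t₀ T) H) (y₀ : E) :
    ∃ y, SolvesIVP (fun t x => F t (x, H t x)) t₀ T y₀ y ∧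
      ∀ v₀ : ℝ → U, ContinuousOn v₀ (Icc t₀ T) →
        ∃ Y : ℕ → ℝ → E, SolvesIVP (fun t x => F t (x, v₀ t)) t₀ T y₀ (Y 0) ∧
          (∀ k, SolvesIVP (fun t x => F t (x, H t (Y k t))) t₀ T y₀ (Y (k + 1))) ∧
          (∃ R, ∀ k, ∀ t ∈ Icc t₀ T, ‖Y k t‖ ≤ R) ∧
          TendstoUniformlyOn Y y atTop (Icc t₀ T) := by
  have hid : TameOn (Icc t₀ T) (fun _ (x : E) => x) := TameOn.clm (ContinuousLinearMap.id ℝ E)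
  have hinput : ∀ v : ℝ → U, ContinuousOn v (Icc t₀ T) →
      TameOn (Icc t₀ T) (fun t (x : E) => F t (x, v t)) := fun v hv =>
    hF.comp (hid.prodMk (TameOn.of_continuousOn isCompact_Icc hv))
  obtain ⟨y, hy⟩ := exists_solvesIVP hT (hF.comp (hid.prodMk hH)) y₀
  refine ⟨y, hy, fun v₀ hv₀ => ?_⟩
  have hstep : ∀ v : {v : ℝ → E // ContinuousOn v (Icc t₀ T)},
      ∃ w : {v : ℝ → E // ContinuousOn v (Icc t₀ T)},
        SolvesIVP (fun t x => F t (x, H t (v.1 t))) t₀ T y₀ w.1 := fun v => by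
    obtain ⟨w, hw⟩ := exists_solvesIVP hT (hinput _ (hH.continuousOn_comp v.2)) y₀
    exact ⟨⟨w, hw.continuousOn⟩, hw⟩
  choose next hnext using hstep
  obtain ⟨w₀, hw₀⟩ := exists_solvesIVP hT (hinput v₀ hv₀) y₀
  let Y : ℕ → {v : ℝ → E // ContinuousOn v (Icc t₀ T)} :=
    fun k => Nat.rec ⟨w₀, hw₀.continuousOn⟩ (fun _ => next) k
  have hY : ∀ k, SolvesIVP (fun t x => F t (x, H t ((Y k).1 t))) t₀ T y₀ (Y (k + 1)).1 :=
    fun k => hnext (Y k)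
  have hexp : ∀ {l : ℝ}, 0 ≤ l → ∀ {t}, t ∈ Icc t₀ T → 1 ≤ Real.exp (l * (t - t₀)) :=
    fun hl t ht => Real.one_le_exp (mul_nonneg hl (sub_nonneg.2 ht.1))
  -- a bound for all iterates
  have hbdd : ∃ R, ∀ k, ∀ t ∈ Icc t₀ T, ‖(Y k).1 t‖ ≤ R := by
    obtain ⟨c, hc, hc'⟩ := (hF.comp (φ := fun t (p : E × E) => (p.1, H t p.2))
      ((TameOn.clm (ContinuousLinearMap.fst ℝ E E)).prodMk
        (hH.comp (TameOn.clm (ContinuousLinearMap.snd ℝ E E))))).growth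
    obtain ⟨A, hA⟩ := isCompact_Icc.exists_bound_of_continuousOn hw₀.continuousOn
    set B : ℝ := |A| + ‖y₀‖ + 1 with hB
    set lam : ℝ := 2 * c + 1 with hlam
    have hB1 : 1 ≤ B := by rw [hB]; linarith [norm_nonneg y₀, abs_nonneg A]
    have hk : ∀ k, ∀ t ∈ Icc t₀ T, ‖(Y k).1 t‖ ≤ B * Real.exp (lam * (t - t₀)) := by
      intro k
      induction k with
      | zero =>
        intro t ht
        have h1 : ‖(Y 0).1 t‖ ≤ A := hA t ht
        have h2 := hexp (l := lam) (by positivity) ht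
        nlinarith [le_abs_self A, norm_nonneg y₀]
      | succ k ih =>
        refine norm_le_exp_barrier (hY k).2 (by
          rw [(hY k).1, hB]; linarith [abs_nonneg A]) fun t ht h => ?_
        have h1 := hc' t ht ((Y (k + 1)).1 t, (Y k).1 t)
        have h2 : ‖((Y (k + 1)).1 t, (Y k).1 t)‖ ≤ B * Real.exp (lam * (t - t₀)) :=
          norm_prod_le_iff.2 ⟨h.le, ih t ht⟩
        have h3 := hexp (l := lam) (by positivity) ht
        have h4 : 1 ≤ B * Real.exp (lam * (t - t₀)) := by nlinarith
        have h5 := mul_le_mul_of_nonneg_left (add_le_add_right h2 1) hc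
        rw [hlam] at *
        simp only at h1
        nlinarith
    refine ⟨B * Real.exp (lam * (T - t₀)), fun k t ht => (hk k t ht).trans ?_⟩
    gcongr
    exact ht.2
  refine ⟨fun k => (Y k).1, hw₀, hY, hbdd, ?_⟩
  obtain ⟨R, hR⟩ := hbdd
  obtain ⟨R', hR'⟩ := isCompact_Icc.exists_bound_of_continuousOn hy.continuousOn
  obtain ⟨K, hK, hK'⟩ := (hF.comp (φ := fun t (p : E × E) => (p.1, H t p.2))
    ((TameOn.clm (ContinuousLinearMap.fst ℝ E E)).prodMk
      (hH.comp (TameOn.clm (ContinuousLinearMap.snd ℝ E E))))).lip (max R R')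
  set A : ℝ := |R| + |R'| + 1 with hA
  have hA0 : 0 < A := by positivity
  set lam : ℝ := 3 * K + 1 with hlam
  have herr : ∀ k, ∀ t ∈ Icc t₀ T,
      ‖(Y k).1 t - y t‖ ≤ A * (1 / 2) ^ k * Real.exp (lam * (t - t₀)) := by
    intro k
    induction k with
    | zero =>
      intro t ht
      have h1 := norm_sub_le ((Y 0).1 t) (y t)
      have h2 := hexp (l := lam) (by positivity) ht
      have h3 := hR 0 t ht
      have h4 := hR' t ht
      rw [pow_zero, mul_one]
      nlinarith [le_abs_self R, le_abs_self R']
    | succ k ih =>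
      refine norm_le_exp_barrier (y := fun t => (Y (k + 1)).1 t - y t)
        (fun t ht => ((hY k).2 t ht).sub (hy.2 t ht)) ?_ fun t ht h => ?_
      · rw [(hY k).1, hy.1, sub_self, norm_zero]
        positivity
      · have h1 := hK' t ht ((Y (k + 1)).1 t, (Y k).1 t) (y t, y t)
          (norm_prod_le_iff.2 ⟨(hR (k + 1) t ht).trans (le_max_left _ _),
            (hR k t ht).trans (le_max_left _ _)⟩)
          (norm_prod_le_iff.2 ⟨(hR' t ht).trans (le_max_right _ _),
            (hR' t ht).trans (le_max_right _ _)⟩)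
        set W : ℝ := A * (1 / 2) ^ (k + 1) * Real.exp (lam * (t - t₀)) with hW
        have hWpos : 0 < W := by positivity
        have h2 : ‖((Y (k + 1)).1 t, (Y k).1 t) - (y t, y t)‖ ≤ 2 * W := by
          rw [Prod.mk_sub_mk]
          refine norm_prod_le_iff.2 ⟨?_, ?_⟩
          · simp only at h ⊢
            linarith
          · refine (ih t ht).trans_eq ?_
            rw [hW, pow_succ]
            ring
        have h3 := mul_le_mul_of_nonneg_left h2 hK
        simp only at h1
        refine (h1.trans h3).trans_lt ?_
        rw [hlam]
        nlinarith
  rw [Metric.tendstoUniformlyOn_iff]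
  intro ε hε
  have hlim : Tendsto (fun k : ℕ => A * (1 / 2 : ℝ) ^ k * Real.exp (lam * (T - t₀))) atTop (𝓝 0) := by
    have := ((tendsto_pow_atTop_nhds_zero_of_lt_one (r := (1 / 2 : ℝ)) (by norm_num)
      (by norm_num)).const_mul A).mul_const (Real.exp (lam * (T - t₀)))
    simpa using this
  filter_upwards [hlim.eventually (gt_mem_nhds hε)] with k hk t ht
  rw [dist_comm, dist_eq_norm]
  refine ((herr k t ht).trans ?_).trans_lt hk
  gcongr
  exact ht.2

end ODE

/-! ### Galerkin equations for strongly monotone maps -/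

/-- Zarantonello's theorem on a subspace: `x ↦ P_S (x - τ Φ(x))` is a contraction for small `τ`. -/
theorem exists_mem_forall_inner_eq_zero {H : Type*} [NormedAddCommGroup H]
    [InnerProductSpace ℝ H] [CompleteSpace H] {Φ : H → H} {μ : ℝ} (hμ : 0 < μ)
    (hmono : ∀ x y, μ * ‖x - y‖ ^ 2 ≤ inner ℝ (x - y) (Φ x - Φ y)) {K : ℝ≥0}
    (hΦ : LipschitzWith K Φ) (S : Submodule ℝ H) [S.HasOrthogonalProjection] :
    ∃ s ∈ S, ∀ s' ∈ S, inner ℝ s' (Φ s) = 0 := by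
  set L : ℝ := K + μ with hL
  have hLpos : 0 < L := by positivity
  set τ : ℝ := μ / L ^ 2 with hτ
  have hτpos : 0 < τ := by positivity
  have hq1 : 1 - μ ^ 2 / L ^ 2 < 1 := by
    have : 0 < μ ^ 2 / L ^ 2 := by positivity
    linarith
  have hq0 : 0 ≤ 1 - μ ^ 2 / L ^ 2 := by
    rw [sub_nonneg, div_le_one (by positivity)]
    have : μ ≤ L := by rw [hL]; linarith [K.2]
    gcongr
  have hest : ∀ x y, ‖(x - τ • Φ x) - (y - τ • Φ y)‖ ≤ √(1 - μ ^ 2 / L ^ 2) * ‖x - y‖ := by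
    intro x y
    have h1 : ‖Φ x - Φ y‖ ≤ L * ‖x - y‖ := by
      have := hΦ.dist_le_mul x y
      rw [dist_eq_norm, dist_eq_norm] at this
      refine this.trans ?_
      gcongr
      rw [hL]; linarith
    have h2 : ‖(x - τ • Φ x) - (y - τ • Φ y)‖ ^ 2 ≤ (1 - μ ^ 2 / L ^ 2) * ‖x - y‖ ^ 2 := by
      have e : (x - τ • Φ x) - (y - τ • Φ y) = (x - y) - τ • (Φ x - Φ y) := by module
      rw [e, norm_sub_sq_real, inner_smul_right, norm_smul, Real.norm_of_nonneg hτpos.le]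
      have h3 := mul_le_mul_of_nonneg_left (hmono x y) hτpos.le
      have h4 : (τ * ‖Φ x - Φ y‖) ^ 2 ≤ (τ * (L * ‖x - y‖)) ^ 2 := by gcongr
      have h5 : (τ * (L * ‖x - y‖)) ^ 2 = μ ^ 2 / L ^ 2 * ‖x - y‖ ^ 2 := by
        rw [hτ]; field_simp
      have h6 : τ * (μ * ‖x - y‖ ^ 2) = μ ^ 2 / L ^ 2 * ‖x - y‖ ^ 2 := by
        rw [hτ]; field_simp
      nlinarith
    refine le_of_sq_le_sq ?_ (by positivity)
    rwa [mul_pow, Real.sq_sqrt hq0]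
  have hcontr : ContractingWith (√(1 - μ ^ 2 / L ^ 2)).toNNReal
      (fun x => S.starProjection (x - τ • Φ x)) := by
    refine ⟨?_, LipschitzWith.of_dist_le_mul fun x y => ?_⟩
    · rw [Real.toNNReal_lt_one, Real.sqrt_lt' one_pos]
      simpa using hq1
    · rw [dist_eq_norm, dist_eq_norm, ← map_sub, Real.coe_toNNReal _ (Real.sqrt_nonneg _)]
      refine (S.starProjection.le_opNorm _).trans ?_
      refine (mul_le_of_le_one_left (norm_nonneg _) S.starProjection_norm_le).trans (hest x y)
  have hfix := hcontr.fixedPoint_isFixedPt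
  set s := hcontr.fixedPoint
  have hs : S.starProjection (s - τ • Φ s) = s := hfix
  refine ⟨s, hs ▸ S.starProjection_apply_mem _, fun s' hs' => ?_⟩
  have h1 := S.starProjection_inner_eq_zero (s - τ • Φ s) s' hs'
  rw [hs, sub_sub_cancel_left, inner_neg_left, inner_smul_left, neg_eq_zero] at h1
  rw [real_inner_comm]
  exact (mul_eq_zero.1 h1).resolve_left hτpos.ne'

lemma IsLipschitzMatrix.continuous {n m : Type*} [Fintype m] {A : (m → ℝ) → Matrix n n ℝ} (hA : IsLipschitzMatrix A) :
    Continuous A := by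
  obtain ⟨c, hc⟩ := hA
  exact continuous_matrix fun i j => (hc i j).continuous

section Galerkin

variable {n m : Type*} [Fintype n] [Fintype m]

lemma dotProduct_le_card_mul (x y : n → ℝ) : x ⬝ᵥ y ≤ Fintype.card n * (‖x‖ * ‖y‖) := by
  have : ∀ i ∈ Finset.univ, x i * y i ≤ ‖x‖ * ‖y‖ := fun i _ => by
    refine (le_abs_self _).trans ?_
    rw [abs_mul]
    exact mul_le_mul (norm_le_pi_norm x i) (norm_le_pi_norm y i) (abs_nonneg _) (norm_nonneg _)
  simpa [dotProduct] using Finset.sum_le_card_nsmul _ _ _ this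

lemma norm_sq_le_dotProduct (x : n → ℝ) : ‖x‖ ^ 2 ≤ x ⬝ᵥ x := by
  have h0 : 0 ≤ x ⬝ᵥ x := Finset.sum_nonneg fun i _ => mul_self_nonneg _
  rw [← Real.sq_sqrt h0]
  gcongr
  refine (pi_norm_le_iff_of_nonneg (Real.sqrt_nonneg _)).2 fun i => ?_
  rw [Real.norm_eq_abs]
  refine Real.abs_le_sqrt ?_
  rw [sq]
  exact Finset.single_le_sum (f := fun i => x i * x i) (fun i _ => mul_self_nonneg _)
    (Finset.mem_univ i)

/-- The Galerkin equation `Φ(s) ⊥ S`, `s ∈ S`, is solvable. -/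
theorem exists_galerkin {Φ : (n → ℝ) → (n → ℝ)} {μ : ℝ} (hμ : 0 < μ)
    (hmono : ∀ x y, μ * ((x - y) ⬝ᵥ (x - y)) ≤ (x - y) ⬝ᵥ (Φ x - Φ y)) {K : ℝ≥0}
    (hΦ : LipschitzWith K Φ) (S : Submodule ℝ (n → ℝ)) :
    ∃ s ∈ S, ∀ s' ∈ S, s' ⬝ᵥ Φ s = 0 := by
  have hdot : ∀ x y : EuclideanSpace ℝ n, inner ℝ x y = x.ofLp ⬝ᵥ y.ofLp := fun x y => by
    rw [EuclideanSpace.inner_eq_star_dotProduct, dotProduct_comm]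
    simp
  have hmono' : ∀ x y : EuclideanSpace ℝ n, μ * ‖x - y‖ ^ 2 ≤
      inner ℝ (x - y) (WithLp.toLp 2 (Φ x.ofLp) - WithLp.toLp 2 (Φ y.ofLp)) := fun x y => by
    rw [← real_inner_self_eq_norm_sq, hdot, hdot]
    exact hmono _ _
  obtain ⟨s, hs, hs'⟩ := exists_mem_forall_inner_eq_zero
    (Φ := fun x : EuclideanSpace ℝ n => WithLp.toLp 2 (Φ x.ofLp)) hμ hmono'
    ((PiLp.lipschitzWith_toLp 2 fun _ : n => ℝ).comp
      (hΦ.comp (PiLp.lipschitzWith_ofLp 2 fun _ : n => ℝ)))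
    (S.comap (WithLp.linearEquiv 2 ℝ (n → ℝ)).toLinearMap)
  refine ⟨s.ofLp, hs, fun s' h => ?_⟩
  have := hs' (WithLp.toLp 2 s') h
  rwa [hdot] at this

/-- Stability of Galerkin equations: `p = Φ₂(s₂)` for a second Galerkin equation gives the
distance of the two solutions in terms of the residual of `s₂` in the first equation. -/
theorem galerkin_norm_sub_le {Φ : (n → ℝ) → (n → ℝ)} {μ : ℝ} (hμ : 0 < μ)
    (hmono : ∀ x y, μ * ((x - y) ⬝ᵥ (x - y)) ≤ (x - y) ⬝ᵥ (Φ x - Φ y))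
    {S : Submodule ℝ (n → ℝ)} {s₁ s₂ p : n → ℝ} (hs₁ : s₁ ∈ S) (hs₂ : s₂ ∈ S)
    (h₁ : ∀ s' ∈ S, s' ⬝ᵥ Φ s₁ = 0) (h₂ : ∀ s' ∈ S, s' ⬝ᵥ p = 0) :
    ‖s₁ - s₂‖ ≤ Fintype.card n / μ * ‖Φ s₂ - p‖ := by
  have hd := S.sub_mem hs₁ hs₂
  have h1 := hmono s₁ s₂
  have h2 : (s₁ - s₂) ⬝ᵥ (Φ s₁ - Φ s₂) = (s₁ - s₂) ⬝ᵥ (p - Φ s₂) := by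
    rw [dotProduct_sub, dotProduct_sub, h₁ _ hd, h₂ _ hd]
  have h3 := dotProduct_le_card_mul (s₁ - s₂) (p - Φ s₂)
  have h4 := mul_le_mul_of_nonneg_left (norm_sq_le_dotProduct (s₁ - s₂)) hμ.le
  rw [h2] at h1
  rw [norm_sub_rev p] at h3
  rcases (norm_nonneg (s₁ - s₂)).eq_or_lt with h0 | h0
  · rw [← h0]; positivity
  · rw [div_mul_eq_mul_div, le_div_iff₀ hμ]
    refine le_of_mul_le_mul_left ?_ h0
    nlinarith

/-- The solution of `f(b + s) + c ⊥ S`, `s ∈ S`, is a Lipschitz continuous function of the data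
`(b, c)` if `f` is strongly monotone and Lipschitz continuous. -/
theorem exists_lipschitz_galerkin {f : (n → ℝ) → (n → ℝ)} (hf : StronglyMonotone f)
    (hf' : IsLipschitz f) (S : Submodule ℝ (n → ℝ)) :
    ∃ G : (n → ℝ) × (n → ℝ) → (n → ℝ), (∃ K, LipschitzWith K G) ∧ (∀ p, G p ∈ S) ∧
      (∀ p, ∀ s' ∈ S, s' ⬝ᵥ (f (p.1 + G p) + p.2) = 0) ∧
      ∀ p, ∀ s ∈ S, (∀ s' ∈ S, s' ⬝ᵥ (f (p.1 + s) + p.2) = 0) → s = G p := by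
  obtain ⟨μ, hμ, hmono⟩ := hf
  obtain ⟨L, hL⟩ := hf'
  have hmono' : ∀ b c x y, μ * ((x - y) ⬝ᵥ (x - y)) ≤
      (x - y) ⬝ᵥ ((f (b + x) + c) - (f (b + y) + c)) := fun b c x y => by
    have := hmono (b + y) (b + x)
    rwa [add_sub_add_left_eq_sub, ← add_sub_add_right_eq_sub (f (b + x)) _ c] at this
  have hLip : ∀ b c, LipschitzWith L (fun x => f (b + x) + c) := fun b c => by
    have := (hL.comp ((isometry_add_left b).lipschitz))
    exact LipschitzWith.of_dist_le_mul fun x y => by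
      simpa using this.dist_le_mul x y
  choose G hGS hG using fun p : (n → ℝ) × (n → ℝ) =>
    exists_galerkin hμ (hmono' p.1 p.2) (hLip p.1 p.2) S
  refine ⟨G, ⟨(Fintype.card n / μ * (L + 1)).toNNReal, ?_⟩, hGS, hG, fun p s hs h => ?_⟩
  · refine LipschitzWith.of_dist_le_mul fun p q => ?_
    rw [dist_eq_norm, dist_eq_norm, Real.coe_toNNReal _ (by positivity), mul_assoc]
    refine (galerkin_norm_sub_le hμ (hmono' p.1 p.2) (hGS p) (hGS q) (hG p) (hG q)).trans ?_
    gcongr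
    rw [add_sub_add_comm, add_mul, one_mul]
    refine (norm_add_le _ _).trans (add_le_add ?_ (norm_snd_le (p - q)))
    have h1 := hL.dist_le_mul (p.1 + G q) (q.1 + G q)
    rw [dist_add_right, dist_eq_norm, dist_eq_norm] at h1
    refine h1.trans ?_
    gcongr
    exact norm_fst_le (p - q)
  · have h1 := galerkin_norm_sub_le hμ (hmono' p.1 p.2) hs (hGS p) h (hG p)
    rw [sub_self, norm_zero, mul_zero] at h1
    exact sub_eq_zero.1 (norm_le_zero_iff.1 h1)

lemma IsLipschitzMatrix.continuous_mulVec {A : (m → ℝ) → Matrix n n ℝ}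
    (hA : IsLipschitzMatrix A) : Continuous (fun p : (m → ℝ) × (n → ℝ) => A p.1 *ᵥ p.2) :=
  (hA.continuous.comp continuous_fst).matrix_mulVec continuous_snd

lemma IsLipschitzMatrix.exists_norm_mulVec_sub_le {A : (m → ℝ) → Matrix n n ℝ}
    (hA : IsLipschitzMatrix A) :
    ∃ L : ℝ, 0 ≤ L ∧ ∀ u u' x, ‖A u *ᵥ x - A u' *ᵥ x‖ ≤ L * ‖u - u'‖ * ‖x‖ := by
  obtain ⟨c, hc⟩ := hA
  refine ⟨Fintype.card n * c, by positivity, fun u u' x => ?_⟩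
  refine (pi_norm_le_iff_of_nonneg (by positivity)).2 fun i => ?_
  rw [← sub_mulVec, Real.norm_eq_abs]
  have h : ∀ j ∈ Finset.univ, |(A u - A u') i j * x j| ≤ c * ‖u - u'‖ * ‖x‖ := fun j _ => by
    rw [abs_mul, Matrix.sub_apply]
    have h1 := (hc i j).dist_le_mul u u'
    rw [dist_eq_norm, dist_eq_norm, Real.norm_eq_abs] at h1
    exact mul_le_mul h1 (norm_le_pi_norm x j) (abs_nonneg _) (by positivity)
  refine (Finset.abs_sum_le_sum_abs _ _).trans ((Finset.sum_le_card_nsmul _ _ _ h).trans_eq ?_)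
  rw [nsmul_eq_mul, Finset.card_univ]
  ring

/-- The solution of `A(u) (b(t) + s) + c ⊥ S`, `s ∈ S`, is tame if `u` and `c` are. The
possibly unbounded matrix `A(u)` enters the bound for `s` only through `A(u) b(t)`, which grows at
most linearly in `u` because `b` does not depend on the state. -/
theorem exists_tame_galerkin {E : Type*} [NormedAddCommGroup E] {I : Set ℝ} (hI : IsCompact I)
    {A : (m → ℝ) → Matrix n n ℝ} (hA : IsLipschitzMatrix A) (hA' : UniformlyPosDef A)
    (S : Submodule ℝ (n → ℝ)) {b : ℝ → n → ℝ} (hb : ContinuousOn b I)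
    {u : ℝ → E → m → ℝ} (hu : TameOn I u) {c : ℝ → E → n → ℝ} (hc : TameOn I c) :
    ∃ s : ℝ → E → n → ℝ, TameOn I s ∧ (∀ t y, s t y ∈ S) ∧
      (∀ t y, ∀ s' ∈ S, s' ⬝ᵥ (A (u t y) *ᵥ (b t + s t y) + c t y) = 0) ∧
      ∀ t y, ∀ σ ∈ S, (∀ s' ∈ S, s' ⬝ᵥ (A (u t y) *ᵥ (b t + σ) + c t y) = 0) → σ = s t y := by
  obtain ⟨μ, hμ, hpos⟩ := hA'
  obtain ⟨L, hL, hL'⟩ := hA.exists_norm_mulVec_sub_le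
  have hmono : ∀ t y, ∀ x x' : n → ℝ, μ * ((x - x') ⬝ᵥ (x - x')) ≤
      (x - x') ⬝ᵥ ((A (u t y) *ᵥ (b t + x) + c t y) - (A (u t y) *ᵥ (b t + x') + c t y)) :=
    fun t y x x' => by
      rw [add_sub_add_right_eq_sub, ← mulVec_sub, add_sub_add_left_eq_sub]
      exact hpos _ _
  have hLip : ∀ t y, ∃ K, LipschitzWith K (fun x => A (u t y) *ᵥ (b t + x) + c t y) :=
    fun t y => by
      have h := (LinearMap.toContinuousLinearMap (A (u t y)).mulVecLin).lipschitz
      exact ⟨‖LinearMap.toContinuousLinearMap (A (u t y)).mulVecLin‖₊,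
        LipschitzWith.of_dist_le_mul fun x x' => by simpa using h.dist_le_mul (b t + x) (b t + x')⟩
  choose s hsS hs using fun t y => exists_galerkin hμ (hmono t y) (hLip t y).choose_spec S
  set C : ℝ := Fintype.card n / μ with hC
  have hC0 : 0 ≤ C := by positivity
  have hcmp : ∀ t y t' y', ‖s t y - s t' y'‖ ≤ C * ‖(A (u t y) *ᵥ (b t + s t' y') + c t y) -
      (A (u t' y') *ᵥ (b t' + s t' y') + c t' y')‖ := fun t y t' y' =>
    galerkin_norm_sub_le hμ (hmono t y) (hsS t y) (hsS t' y') (hs t y) (hs t' y')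
  obtain ⟨β, hβ⟩ := hI.exists_bound_of_continuousOn hb
  have hgrowth : ∃ k : ℝ, 0 ≤ k ∧ ∀ t ∈ I, ∀ y, ‖s t y‖ ≤ k * (1 + ‖y‖) := by
    obtain ⟨B, hB⟩ := hI.exists_bound_of_continuousOn (f := fun t => A 0 *ᵥ b t)
      ((Continuous.matrix_mulVec continuous_const continuous_id).comp_continuousOn hb)
    obtain ⟨k, hk, hk'⟩ := hu.growth
    obtain ⟨l, hl, hl'⟩ := hc.growth
    refine ⟨C * (L * k * |β| + |B| + l), by positivity, fun t ht y => ?_⟩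
    have h1 := galerkin_norm_sub_le hμ (hmono t y) (hsS t y) S.zero_mem (hs t y) (p := 0)
      fun s' _ => dotProduct_zero s'
    rw [sub_zero, sub_zero, add_zero] at h1
    rw [mul_assoc]
    refine h1.trans ?_
    gcongr
    have h2 := hL' (u t y) 0 (b t)
    rw [sub_zero] at h2
    have h3 : ‖A (u t y) *ᵥ b t‖ ≤ ‖A (u t y) *ᵥ b t - A 0 *ᵥ b t‖ + ‖A 0 *ᵥ b t‖ := by
      simpa using norm_add_le (A (u t y) *ᵥ b t - A 0 *ᵥ b t) (A 0 *ᵥ b t)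
    have h4 : L * ‖u t y‖ * ‖b t‖ ≤ L * (k * (1 + ‖y‖)) * |β| := by
      gcongr
      · exact hk' t ht y
      · exact (hβ t ht).trans (le_abs_self _)
    have h5 := (hB t ht).trans (le_abs_self B)
    have h6 := hl' t ht y
    have h7 := norm_add_le (A (u t y) *ᵥ b t) (c t y)
    nlinarith [abs_nonneg B, norm_nonneg y]
  refine ⟨s, ⟨fun p hp => ?_, fun R => ?_, hgrowth⟩, hsS, hs, fun t y σ hσ h => ?_⟩
  · have hcont : ContinuousOn (fun q : ℝ × E =>
        C * ‖(A (u q.1 q.2) *ᵥ (b q.1 + s p.1 p.2) + c q.1 q.2) -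
          (A (u p.1 p.2) *ᵥ (b p.1 + s p.1 p.2) + c p.1 p.2)‖) (I ×ˢ univ) := by
      refine continuousOn_const.mul (ContinuousOn.norm (ContinuousOn.sub (ContinuousOn.add ?_
        hc.cont) continuousOn_const))
      exact hA.continuous_mulVec.comp_continuousOn (hu.cont.prodMk
        ((hb.comp continuousOn_fst fun q hq => hq.1).add continuousOn_const))
    have h0 := (hcont p hp).tendsto
    simp only [sub_self, norm_zero, mul_zero] at h0
    refine tendsto_iff_norm_sub_tendsto_zero.2 (squeeze_zero (fun _ => norm_nonneg _)
      (fun q => hcmp q.1 q.2 p.1 p.2) h0)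
  · obtain ⟨k, hk, hk'⟩ := hu.lip R
    obtain ⟨l, hl, hl'⟩ := hc.lip R
    obtain ⟨γ, hγ, hγ'⟩ := hgrowth
    refine ⟨C * (L * k * (|β| + γ * (1 + |R|)) + l), by positivity, fun t ht x y hx hy => ?_⟩
    rw [mul_assoc]
    refine (hcmp t x t y).trans ?_
    gcongr
    rw [add_sub_add_comm]
    refine (norm_add_le _ _).trans ?_
    rw [add_mul]
    refine add_le_add ?_ (hl' t ht x y hx hy)
    refine (hL' _ _ _).trans ?_
    have h1 : ‖b t + s t y‖ ≤ |β| + γ * (1 + |R|) := by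
      refine (norm_add_le _ _).trans (add_le_add ((hβ t ht).trans (le_abs_self _))
        ((hγ' t ht y).trans ?_))
      gcongr
      exact hy.trans (le_abs_self R)
    calc L * ‖u t x - u t y‖ * ‖b t + s t y‖
        ≤ L * (k * ‖x - y‖) * (|β| + γ * (1 + |R|)) := by
          gcongr
          exact hk' t ht x y hx hy
      _ = L * k * (|β| + γ * (1 + |R|)) * ‖x - y‖ := by ring
  · have h1 := galerkin_norm_sub_le hμ (hmono t y) hσ (hsS t y) h (hs t y)
    rw [sub_self, norm_zero, mul_zero] at h1
    exact sub_eq_zero.1 (norm_le_zero_iff.1 h1)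

end Galerkin

/-! ### Splitting of the node potentials -/

lemma dotProduct_mulVec_eq {m n : Type*} [Fintype m] [Fintype n] (A : Matrix m n ℝ) (x : m → ℝ)
    (y : n → ℝ) : x ⬝ᵥ (A *ᵥ y) = (Aᵀ *ᵥ x) ⬝ᵥ y := by
  rw [dotProduct_mulVec, mulVec_transpose]

lemma dotProduct_mulVec_of_mul_eq_zero {m n : Type*} [Fintype m] [Fintype n] {A : Matrix m n ℝ}
    {P : Matrix m m ℝ} (h : Aᵀ * P = 0) (z : m → ℝ) (x : n → ℝ) : (P *ᵥ z) ⬝ᵥ (A *ᵥ x) = 0 := by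
  rw [dotProduct_mulVec_eq, mulVec_mulVec, h, zero_mulVec, zero_dotProduct]

lemma transpose_mulVec_of_mul_eq_zero {m n : Type*} [Fintype m] [Fintype n] {A : Matrix m n ℝ}
    {P : Matrix m m ℝ} (h : Aᵀ * P = 0) (x : n → ℝ) : Pᵀ *ᵥ (A *ᵥ x) = 0 := by
  have h' := congrArg Matrix.transpose h
  rw [transpose_mul, transpose_transpose, transpose_zero] at h'
  rw [mulVec_mulVec, h', zero_mulVec]

lemma eq_of_forall_dotProduct_eq {n : Type*} [Fintype n] {x y : n → ℝ}
    (h : ∀ z, z ⬝ᵥ x = z ⬝ᵥ y) : x = y := by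
  classical
  funext i
  simpa using h (Pi.single i 1)

/-- Every matrix has a generalised inverse. -/
theorem exists_generalized_inverse {m n : Type*} [Fintype m] [Fintype n] (B : Matrix m n ℝ) :
    ∃ G : Matrix n m ℝ, B * G * B = B := by
  classical
  let f := Matrix.toLin' B
  obtain ⟨g, hg⟩ := f.rangeRestrict.exists_rightInverse_of_surjective f.range_rangeRestrict
  obtain ⟨g', hg'⟩ := LinearMap.exists_extend g
  refine ⟨LinearMap.toMatrix' g', ?_⟩
  apply Matrix.toLin'.injective
  rw [Matrix.toLin'_mul, Matrix.toLin'_mul, Matrix.toLin'_toMatrix']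
  refine LinearMap.ext fun x => ?_
  have h1 : g' (f x) = g (f.rangeRestrict x) :=
    LinearMap.congr_fun hg' (f.rangeRestrict x)
  have h2 := LinearMap.congr_fun hg (f.rangeRestrict x)
  change f (g' (f x)) = f x
  rw [h1]
  exact congrArg Subtype.val h2

section Splitting

variable {N C R L V F : Type*} [Fintype N] [DecidableEq N] [Fintype C] [Fintype R] [Fintype L]
  [Fintype V]

/-- A stepwise decomposition `e = T_V A_Vᵀ e + P_V e`, `P_V e = T_C A_Cᵀ P_V e + P_C e`,
`P_C e = T_R A_Rᵀ P_C e + P_R e`, `P_R e = T_L A_Lᵀ P_R e` of the node potentials: the ranges of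
`P_V`, `P_C` and `P_R` are the potentials that vanish on voltage sources, on voltage sources and
capacitors, and on voltage sources, capacitors and resistors. The matrices `T` recover the
respective parts from the branch voltages. Potentials in the range of `P_R` are not seen by the EM
field elements. -/
structure NodeSplitting (AC : Matrix N C ℝ) (AR : Matrix N R ℝ) (AL : Matrix N L ℝ)
    (AV : Matrix N V ℝ) (Am : Matrix N F ℝ) where
  PV : Matrix N N ℝ
  PC : Matrix N N ℝ
  PR : Matrix N N ℝ
  TV : Matrix N V ℝ
  TC : Matrix N C ℝ
  TR : Matrix N R ℝ
  TL : Matrix N L ℝ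
  TV_AV : ∀ i, TVᵀ *ᵥ (AV *ᵥ i) = i
  split_V : TV * AVᵀ + PV = 1
  split_C : TC * ACᵀ * PV + PC = PV
  split_R : TR * ARᵀ * PC + PR = PC
  split_L : TL * ALᵀ * PR = PR
  AV_PV : AVᵀ * PV = 0
  AV_PC : AVᵀ * PC = 0
  AV_TC : AVᵀ * TC = 0
  AV_TR : AVᵀ * TR = 0
  AV_TL : AVᵀ * TL = 0
  AV_PR : AVᵀ * PR = 0
  AC_PC : ACᵀ * PC = 0
  AC_TR : ACᵀ * TR = 0
  AC_TL : ACᵀ * TL = 0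
  AC_PR : ACᵀ * PR = 0
  AR_PR : ARᵀ * PR = 0
  AR_TL : ARᵀ * TL = 0
  Am_PR : Amᵀ * PR = 0
  Am_TL : Amᵀ * TL = 0

theorem NodeSplitting.nonempty {AC : Matrix N C ℝ} {AR : Matrix N R ℝ} {AL : Matrix N L ℝ}
    {AV : Matrix N V ℝ} {Am : Matrix N F ℝ} (hV : LinearIndependent ℝ AV.col)
    (hrow : LinearIndependent ℝ (fromCols (fromCols AC AV) (fromCols AR AL)).row)
    (hm : ∀ e, ACᵀ *ᵥ e = 0 → AVᵀ *ᵥ e = 0 → ARᵀ *ᵥ e = 0 → Amᵀ *ᵥ e = 0) :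
    Nonempty (NodeSplitting AC AR AL AV Am) := by
  have hker : ∀ e, ACᵀ *ᵥ e = 0 → AVᵀ *ᵥ e = 0 → ARᵀ *ᵥ e = 0 → ALᵀ *ᵥ e = 0 → e = 0 := by
    intro e h1 h2 h3 h4
    rw [mulVec_transpose] at h1 h2 h3 h4
    refine vecMul_injective_iff.2 hrow ?_
    simp [vecMul_fromCols, h1, h2, h3, h4]
  obtain ⟨TV, hTV⟩ := exists_generalized_inverse AVᵀ
  have hTV' : ∀ i, TVᵀ *ᵥ (AV *ᵥ i) = i := fun i => by
    refine mulVec_injective_iff.2 hV ?_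
    have h := congrArg Matrix.transpose hTV
    simp only [transpose_mul, transpose_transpose] at h
    simp only [mulVec_mulVec, h]
  obtain ⟨PV, hPV⟩ : ∃ P, P = 1 - TV * AVᵀ := ⟨_, rfl⟩
  obtain ⟨GC, hGC⟩ := exists_generalized_inverse (ACᵀ * PV)
  obtain ⟨PC, hPC⟩ : ∃ P, P = PV - PV * GC * ACᵀ * PV := ⟨_, rfl⟩
  obtain ⟨GR, hGR⟩ := exists_generalized_inverse (ARᵀ * PC)
  obtain ⟨PR, hPR⟩ : ∃ P, P = PC - PC * GR * ARᵀ * PC := ⟨_, rfl⟩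
  obtain ⟨Gind, hGind⟩ := exists_generalized_inverse (ALᵀ * PR)
  have e1 : AVᵀ * PV = 0 := by
    rw [hPV, Matrix.mul_sub, Matrix.mul_one, ← Matrix.mul_assoc, hTV, sub_self]
  have e2 : AVᵀ * PC = 0 := by
    simp only [hPC, Matrix.mul_sub, ← Matrix.mul_assoc, e1, Matrix.zero_mul, sub_self]
  have e3 : AVᵀ * PR = 0 := by
    simp only [hPR, Matrix.mul_sub, ← Matrix.mul_assoc, e2, Matrix.zero_mul, sub_self]
  have c1 : ACᵀ * PC = 0 := by
    rw [hPC, Matrix.mul_sub, sub_eq_zero]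
    simpa only [Matrix.mul_assoc] using hGC.symm
  have c2 : ACᵀ * PR = 0 := by
    simp only [hPR, Matrix.mul_sub, ← Matrix.mul_assoc, c1, Matrix.zero_mul, sub_self]
  have r1 : ARᵀ * PR = 0 := by
    rw [hPR, Matrix.mul_sub, sub_eq_zero]
    simpa only [Matrix.mul_assoc] using hGR.symm
  have m1 : Amᵀ * PR = 0 := by
    ext i j
    have h := hm (PR *ᵥ Pi.single j 1) (by rw [mulVec_mulVec, c2, zero_mulVec])
      (by rw [mulVec_mulVec, e3, zero_mulVec]) (by rw [mulVec_mulVec, r1, zero_mulVec])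
    rw [mulVec_mulVec] at h
    simpa using congrFun h i
  have l1 : ∀ z, (PR - PR * Gind * ALᵀ * PR) *ᵥ z = 0 := fun z => by
    refine hker _ ?_ ?_ ?_ ?_ <;> rw [mulVec_mulVec, Matrix.mul_sub]
    · simp only [← Matrix.mul_assoc, c2, Matrix.zero_mul, sub_self, zero_mulVec]
    · simp only [← Matrix.mul_assoc, e3, Matrix.zero_mul, sub_self, zero_mulVec]
    · simp only [← Matrix.mul_assoc, r1, Matrix.zero_mul, sub_self, zero_mulVec]
    · have : ALᵀ * PR - ALᵀ * (PR * Gind * ALᵀ * PR) = 0 := by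
        rw [sub_eq_zero]
        simpa only [Matrix.mul_assoc] using hGind.symm
      rw [this, zero_mulVec]
  have l2 : PR * Gind * ALᵀ * PR = PR := by
    refine (sub_eq_zero.1 ?_).symm
    ext i j
    simpa using congrFun (l1 (Pi.single j 1)) i
  exact ⟨{
    PV := PV, PC := PC, PR := PR, TV := TV, TC := PV * GC, TR := PC * GR, TL := PR * Gind
    TV_AV := hTV'
    split_V := by rw [hPV]; abel
    split_C := by rw [hPC]; abel
    split_R := by rw [hPR]; abel
    split_L := l2
    AV_PV := e1, AV_PC := e2, AV_PR := e3
    AV_TC := by rw [← Matrix.mul_assoc, e1, Matrix.zero_mul]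
    AV_TR := by rw [← Matrix.mul_assoc, e2, Matrix.zero_mul]
    AV_TL := by rw [← Matrix.mul_assoc, e3, Matrix.zero_mul]
    AC_PC := c1, AC_PR := c2
    AC_TR := by rw [← Matrix.mul_assoc, c1, Matrix.zero_mul]
    AC_TL := by rw [← Matrix.mul_assoc, c2, Matrix.zero_mul]
    AR_PR := r1
    AR_TL := by rw [← Matrix.mul_assoc, r1, Matrix.zero_mul]
    Am_PR := m1
    Am_TL := by rw [← Matrix.mul_assoc, m1, Matrix.zero_mul] }⟩

end Splitting

section CVR

variable {N C R L V F : Type*} [Fintype N] [DecidableEq N]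

lemma Branches.incidence_transpose_mulVec {B : Type*} (br : Branches N B) (e : N → ℝ) (b : B) :
    (br.incidenceᵀ *ᵥ e) b = (br.tail b).elim 0 e - (br.head b).elim 0 e := by
  have h : ∀ p : Option N, ∑ n, (if p = some n then (1 : ℝ) else 0) * e n = p.elim 0 e := by
    intro p
    cases p <;> simp
  simp only [mulVec, dotProduct, transpose_apply, Branches.incidence, of_apply, sub_mul,
    Finset.sum_sub_distrib, h]

lemma Branches.Joins.elim_eq {B : Type*} {br : Branches N B} {e : N → ℝ}
    (he : br.incidenceᵀ *ᵥ e = 0) {b : B} {p q : Option N} (h : br.Joins b p q) :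
    p.elim 0 e = q.elim 0 e := by
  have h1 := congrFun he b
  rw [br.incidence_transpose_mulVec, Pi.zero_apply, sub_eq_zero] at h1
  rcases h with ⟨rfl, rfl⟩ | ⟨rfl, rfl⟩
  · exact h1
  · exact h1.symm

/-- If the voltages of all capacitors, voltage sources and resistors vanish, then the potential is
constant along CVR paths, so that the voltages of the EM field elements vanish, too. -/
theorem Circuit.Am_transpose_mulVec_eq_zero (ci : Circuit N C R L V F)
    (hCVR : ∀ m, ci.HasParallelCVRPath m) {e : N → ℝ} (hC : ci.ACᵀ *ᵥ e = 0)
    (hV : ci.AVᵀ *ᵥ e = 0) (hR : ci.ARᵀ *ᵥ e = 0) : ci.Amᵀ *ᵥ e = 0 := by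
  have hwalk : ∀ {p q : Option N}, ci.cvrGraph.Walk p q → p.elim 0 e = q.elim 0 e := by
    intro p q w
    induction w with
    | nil => rfl
    | cons h _ ih =>
      refine Eq.trans ?_ ih
      rcases h.2 with ⟨b, hb⟩ | ⟨b, hb⟩ | ⟨b, hb⟩
      · exact hb.elim_eq hC
      · exact hb.elim_eq hV
      · exact hb.elim_eq hR
  funext m
  rw [Circuit.Am, Branches.incidence_transpose_mulVec, Pi.zero_apply, sub_eq_zero]
  exact hwalk (hCVR m).choose

end CVR

/-! ### Reduction of the field model to an ordinary differential equation -/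

lemma ContinuousOn.mulVec {m n : Type*} [Fintype n] {E : Type*} [TopologicalSpace E] {S : Set E} (A : Matrix m n ℝ)
    {φ : E → n → ℝ} (h : ContinuousOn φ S) : ContinuousOn (fun q => A *ᵥ φ q) S :=
  (Continuous.matrix_mulVec continuous_const continuous_id).comp_continuousOn h

section MulVec

variable {m n : Type*} [Fintype m] [Fintype n]

lemma hasDerivWithinAt_mulVec (A : Matrix m n ℝ) {f : ℝ → n → ℝ} {f' : n → ℝ} {S : Set ℝ} {t : ℝ}
    (h : HasDerivWithinAt f f' S t) : HasDerivWithinAt (fun s => A *ᵥ f s) (A *ᵥ f') S t :=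
  (LinearMap.toContinuousLinearMap A.mulVecLin).hasFDerivAt.comp_hasDerivWithinAt t h

lemma TameOn.mulVec {E : Type*} [NormedAddCommGroup E] {I : Set ℝ} (A : Matrix m n ℝ)
    {φ : ℝ → E → n → ℝ} (h : TameOn I φ) : TameOn I (fun t x => A *ᵥ φ t x) :=
  h.clm_comp (LinearMap.toContinuousLinearMap A.mulVecLin)

lemma exists_lipschitzWith_mulVec (A : Matrix m n ℝ) : ∃ K, LipschitzWith K (fun x => A *ᵥ x) :=
  ⟨_, (LinearMap.toContinuousLinearMap A.mulVecLin).lipschitz⟩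

end MulVec

/-- A function with vanishing derivative on `[t₀, T]` vanishes if it vanishes initially. -/
lemma eq_zero_of_hasDerivWithinAt_zero {E : Type*} [NormedAddCommGroup E] [NormedSpace ℝ E]
    {D : ℝ → E} {t₀ T : ℝ} (hD : ∀ t ∈ Icc t₀ T, HasDerivWithinAt D 0 (Icc t₀ T) t)
    (h₀ : D t₀ = 0) : ∀ t ∈ Icc t₀ T, D t = 0 := fun t ht => by
  rw [← h₀]
  exact constant_of_has_deriv_right_zero (fun s hs => (hD s hs).continuousWithinAt)
    (fun s hs => hasDerivWithinAt_Ici hs (hD s (Ico_subset_Icc_self hs))) t ht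

section Field

variable {ι F : Type*} [Fintype ι] [Fintype F]

/-- If `X` is injective, then `T = X (Xᵀ X)⁻¹` is a right inverse of `Xᵀ`. -/
lemma exists_right_inverse_transpose {X : Matrix ι F ℝ} (hX : LinearIndependent ℝ X.col) :
    ∃ G : Matrix F F ℝ, (∀ i, (X * G)ᵀ *ᵥ (X *ᵥ i) = i) ∧ ∀ w, Xᵀ *ᵥ ((X * G) *ᵥ w) = w := by
  obtain ⟨G, hG⟩ := exists_generalized_inverse (Xᵀ * X)
  have hinj : ∀ y, (Xᵀ * X) *ᵥ y = 0 → y = 0 := fun y hy => by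
    refine mulVec_injective_iff.2 hX ?_
    have h : (X *ᵥ y) ⬝ᵥ (X *ᵥ y) = 0 := by
      rw [dotProduct_mulVec_eq, mulVec_mulVec, hy, zero_dotProduct]
    simpa using dotProduct_self_eq_zero.1 h
  have h1 : ∀ i, G *ᵥ ((Xᵀ * X) *ᵥ i) = i := fun i => by
    refine sub_eq_zero.1 (hinj _ ?_)
    rw [mulVec_sub, mulVec_mulVec, mulVec_mulVec, hG, sub_self]
  refine ⟨Gᵀ, fun i => ?_, fun w => ?_⟩
  · rw [transpose_mul, transpose_transpose, mulVec_mulVec, Matrix.mul_assoc, ← mulVec_mulVec]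
    exact h1 i
  · refine eq_of_forall_dotProduct_eq fun z => ?_
    rw [mulVec_mulVec, dotProduct_mulVec_eq, ← Matrix.mul_assoc, transpose_mul, transpose_mul,
      transpose_transpose, transpose_transpose, ← mulVec_mulVec, h1]

/-- The field system with input `v` is equivalent to an ordinary differential equation for
`(w, η) = (Xᵀ a, M a)` with Lipschitz continuous right hand side `(v, φ(w, η))`. With a right
inverse `T_X` of `Xᵀ` into `ker M` and a generalised inverse `T_M` of `M` into `ker Xᵀ`, one has
`a = T_X w + T_M η + s` where `s ∈ ker M ∩ ker Xᵀ` is found from the Galerkin equation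
`K(a) a ⊥ ker M ∩ ker Xᵀ`, and the current is `i_m = T_Xᵀ K(a) a`. -/
theorem FieldModel.exists_reduction {fm : FieldModel ι F} (hfm : fm.Admissible)
    (hXM : fm.Xᵀ * fm.M = 0) (hK : IsLipschitz (fun a => fm.K a *ᵥ a)) :
    ∃ (α : (F → ℝ) × (ι → ℝ) → ι → ℝ) (c : (F → ℝ) × (ι → ℝ) → F → ℝ)
      (φ : (F → ℝ) × (ι → ℝ) → ι → ℝ),
      (∃ k, LipschitzWith k α) ∧ (∃ k, LipschitzWith k c) ∧ (∃ k, LipschitzWith k φ) ∧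
      (∀ (t₀ T : ℝ) (a : ℝ → ι → ℝ) (im v : ℝ → F → ℝ), t₀ < T → fm.IsSolution t₀ T a im v →
        ∀ t ∈ Icc t₀ T,
          HasDerivWithinAt (fun s => (fm.Xᵀ *ᵥ a s, fm.M *ᵥ a s))
            (v t, φ (fm.Xᵀ *ᵥ a t, fm.M *ᵥ a t)) (Icc t₀ T) t ∧
          a t = α (fm.Xᵀ *ᵥ a t, fm.M *ᵥ a t) ∧ im t = c (fm.Xᵀ *ᵥ a t, fm.M *ᵥ a t)) ∧
      ∀ (t₀ T : ℝ) (y : ℝ → (F → ℝ) × (ι → ℝ)) (v : ℝ → F → ℝ), ContinuousOn v (Icc t₀ T) →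
        (∀ t ∈ Icc t₀ T, HasDerivWithinAt y (v t, φ (y t)) (Icc t₀ T) t) →
        fm.IsSolution t₀ T (fun t => α (y t)) (fun t => c (y t)) v := by
  obtain ⟨M, K, X⟩ := fm
  simp only at hXM hK
  have hsymm : Mᵀ = M := hfm.symm_M
  have hMX : M * X = 0 := by
    have := congrArg Matrix.transpose hXM
    rwa [transpose_mul, transpose_transpose, hsymm, transpose_zero] at this
  obtain ⟨G₁, hTX', hTX⟩ := exists_right_inverse_transpose hfm.fullColumnRank_X
  simp only at hTX hTX'
  obtain ⟨TX, hTXdef⟩ : ∃ TX, TX = X * G₁ := ⟨_, rfl⟩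
  rw [← hTXdef] at hTX hTX'
  have hMTX : ∀ w, M *ᵥ (TX *ᵥ w) = 0 := fun w => by
    rw [hTXdef, mulVec_mulVec, ← Matrix.mul_assoc, hMX, Matrix.zero_mul, zero_mulVec]
  have hTXM : ∀ a, TXᵀ *ᵥ (M *ᵥ a) = 0 := fun a => eq_of_forall_dotProduct_eq fun z => by
    rw [dotProduct_mulVec_eq, dotProduct_mulVec_eq, transpose_transpose, hsymm, hMTX,
      zero_dotProduct, dotProduct_zero]
  obtain ⟨G₂, hG₂⟩ := exists_generalized_inverse M
  have hG₂' : ∀ a, M *ᵥ (G₂ *ᵥ (M *ᵥ a)) = M *ᵥ a := fun a => by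
    rw [mulVec_mulVec, mulVec_mulVec, hG₂]
  -- the part of `G₂` in the kernel of `Xᵀ`
  let TM : (ι → ℝ) → (ι → ℝ) := fun η => G₂ *ᵥ η - TX *ᵥ (Xᵀ *ᵥ (G₂ *ᵥ η))
  have hXTM : ∀ η, Xᵀ *ᵥ TM η = 0 := fun η => by
    simp only [TM]; rw [mulVec_sub, hTX, sub_self]
  have hMTM : ∀ η, M *ᵥ TM η = M *ᵥ (G₂ *ᵥ η) := fun η => by
    simp only [TM]; rw [mulVec_sub, hMTX, sub_zero]
  let S : Submodule ℝ (ι → ℝ) := LinearMap.ker M.mulVecLin ⊓ LinearMap.ker Xᵀ.mulVecLin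
  have hS : ∀ s, s ∈ S ↔ M *ᵥ s = 0 ∧ Xᵀ *ᵥ s = 0 := fun s => by
    simp only [S, Submodule.mem_inf, LinearMap.mem_ker, mulVecLin_apply]
  obtain ⟨G, ⟨kG, hGlip⟩, hGS, hG, hGuniq⟩ :=
    exists_lipschitz_galerkin hfm.stronglyMonotone hK S
  simp only at hGS hG hGuniq
  let β : (F → ℝ) × (ι → ℝ) → ι → ℝ := fun p => TX *ᵥ p.1 + TM p.2
  let α : (F → ℝ) × (ι → ℝ) → ι → ℝ := fun p => β p + G (β p, 0)
  let c : (F → ℝ) × (ι → ℝ) → F → ℝ := fun p => TXᵀ *ᵥ (K (α p) *ᵥ α p)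
  let φ : (F → ℝ) × (ι → ℝ) → ι → ℝ := fun p => X *ᵥ c p - K (α p) *ᵥ α p
  obtain ⟨kK, hKlip⟩ := hK
  have hα : ∃ k, LipschitzWith k α := by
    obtain ⟨k₁, h₁⟩ := exists_lipschitzWith_mulVec TX
    obtain ⟨k₂, h₂⟩ := exists_lipschitzWith_mulVec G₂
    obtain ⟨k₃, h₃⟩ := exists_lipschitzWith_mulVec Xᵀ
    have hβ := (h₁.comp LipschitzWith.prod_fst).add ((h₂.comp LipschitzWith.prod_snd).sub
      (h₁.comp (h₃.comp (h₂.comp (LipschitzWith.prod_snd (α := F → ℝ) (β := ι → ℝ))))))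
    exact ⟨_, hβ.add (hGlip.comp (hβ.prodMk (LipschitzWith.const 0)))⟩
  have hc : ∃ k, LipschitzWith k c := by
    obtain ⟨k₁, h₁⟩ := exists_lipschitzWith_mulVec TXᵀ
    exact ⟨_, h₁.comp (hKlip.comp hα.choose_spec)⟩
  have hφ : ∃ k, LipschitzWith k φ := by
    obtain ⟨k₁, h₁⟩ := exists_lipschitzWith_mulVec X
    exact ⟨_, (h₁.comp hc.choose_spec).sub (hKlip.comp hα.choose_spec)⟩
  have hXα : ∀ p, Xᵀ *ᵥ α p = p.1 := fun p => by
    simp only [α, β]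
    rw [mulVec_add, mulVec_add, hTX, hXTM, ((hS _).1 (hGS _)).2, add_zero, add_zero]
  have hMα : ∀ p, M *ᵥ α p = M *ᵥ (G₂ *ᵥ p.2) := fun p => by
    simp only [α, β]
    rw [mulVec_add, mulVec_add, hMTX, hMTM, ((hS _).1 (hGS _)).1, add_zero, zero_add]
  -- the right hand side lies in the range of `M`, the orthogonal complement of the kernel of `M`
  have hMφ : ∀ p, M *ᵥ (G₂ *ᵥ φ p) = φ p := fun p => by
    refine eq_of_forall_dotProduct_eq fun z => ?_
    have hz : M *ᵥ (z - G₂ᵀ *ᵥ (M *ᵥ z)) = 0 := by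
      have h := congrArg Matrix.transpose hG₂
      rw [transpose_mul, transpose_mul, hsymm, ← Matrix.mul_assoc] at h
      rw [mulVec_sub, mulVec_mulVec, mulVec_mulVec, h, sub_self]
    obtain ⟨z', hz'⟩ : ∃ z', z' = z - G₂ᵀ *ᵥ (M *ᵥ z) := ⟨_, rfl⟩
    rw [← hz'] at hz
    have hmem : z' - TX *ᵥ (Xᵀ *ᵥ z') ∈ S := by
      rw [hS, mulVec_sub, mulVec_sub, hz, hMTX, hTX, sub_self, sub_self]
      exact ⟨rfl, rfl⟩
    have h1 := hG (β p, 0) _ hmem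
    rw [add_zero] at h1
    have h2 : z' ⬝ᵥ φ p = 0 := by
      simp only [φ, c]
      rw [dotProduct_sub, dotProduct_mulVec_eq, dotProduct_mulVec_eq, transpose_transpose,
        ← sub_dotProduct, ← neg_sub, neg_dotProduct, neg_eq_zero]
      exact h1
    rw [hz', sub_dotProduct, sub_eq_zero] at h2
    rw [dotProduct_mulVec_eq, dotProduct_mulVec_eq, hsymm, h2]
  refine ⟨α, c, φ, hα, hc, hφ, ?_, ?_⟩
  · rintro t₀ T a im v hT ⟨_, _, dMa, dXa, _, _, hsol⟩ t ht
    obtain ⟨h1, h2, h3, h4⟩ := hsol t ht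
    simp only at h1 h2 h3 h4
    have hdM : M *ᵥ (G₂ *ᵥ dMa t) = dMa t := by
      have h5 := hasDerivWithinAt_mulVec M (hasDerivWithinAt_mulVec G₂ h1)
      simp only [hG₂'] at h5
      exact (uniqueDiffOn_Icc hT t ht).eq_deriv _ h5 h1
    have him : im t = TXᵀ *ᵥ (K (a t) *ᵥ a t) := by
      have h5 : K (a t) *ᵥ a t = X *ᵥ im t - dMa t := by rw [← sub_eq_zero, ← h3]; abel
      rw [h5, mulVec_sub, hTX', ← hdM, hTXM, sub_zero]
    have ha : a t = α (Xᵀ *ᵥ a t, M *ᵥ a t) := by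
      have hmem : a t - β (Xᵀ *ᵥ a t, M *ᵥ a t) ∈ S := by
        rw [hS]
        simp only [β]
        rw [mulVec_sub, mulVec_add, hMTX, hMTM, hG₂', zero_add, sub_self, mulVec_sub, mulVec_add,
          hTX, hXTM, add_zero, sub_self]
        exact ⟨rfl, rfl⟩
      have h5 := hGuniq (β (Xᵀ *ᵥ a t, M *ᵥ a t), 0) _ hmem fun s' hs' => by
        have h6 : K (a t) *ᵥ a t = X *ᵥ im t - dMa t := by rw [← sub_eq_zero, ← h3]; abel
        obtain ⟨h7, h8⟩ := (hS s').1 hs'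
        rw [add_sub_cancel, add_zero, h6, ← hdM, dotProduct_sub, dotProduct_mulVec_eq, h8,
          dotProduct_mulVec_eq, hsymm, h7, zero_dotProduct, zero_dotProduct, sub_self]
      simp only [α]
      rw [← h5, add_sub_cancel]
    have him' : im t = c (Xᵀ *ᵥ a t, M *ᵥ a t) := by
      simp only [c]
      rw [← ha, him]
    refine ⟨?_, ha, him'⟩
    have hd : dMa t = φ (Xᵀ *ᵥ a t, M *ᵥ a t) := by
      simp only [φ]
      rw [← him', ← ha, eq_sub_iff_add_eq, ← sub_eq_zero, ← h3]
    rw [← hd, ← h4]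
    exact h2.prodMk h1
  · intro t₀ T y v hv hy
    have hyc : ContinuousOn y (Icc t₀ T) := fun t ht => (hy t ht).continuousWithinAt
    refine ⟨hα.choose_spec.continuous.comp_continuousOn hyc,
      hc.choose_spec.continuous.comp_continuousOn hyc, fun t => φ (y t), v,
      hφ.choose_spec.continuous.comp_continuousOn hyc, hv, fun t ht => ⟨?_, ?_, ?_, rfl⟩⟩
    · simp only [hMα]
      have h1 := (hasFDerivAt_snd (𝕜 := ℝ) (p := y t)).comp_hasDerivWithinAt t (hy t ht)
      have h2 := hasDerivWithinAt_mulVec M (hasDerivWithinAt_mulVec G₂ h1)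
      simp only [Function.comp_def, ContinuousLinearMap.coe_snd', hMφ] at h2
      exact h2
    · simp only [hXα]
      exact (hasFDerivAt_fst (𝕜 := ℝ) (p := y t)).comp_hasDerivWithinAt t (hy t ht)
    · simp only [φ]
      abel

end Field

/-! ### Reduction of the circuit to an ordinary differential equation -/

section Splitting

variable {N C R L V F : Type*} [Fintype N] [DecidableEq N] [Fintype C] [Fintype R] [Fintype L]
  [Fintype V] {AC : Matrix N C ℝ} {AR : Matrix N R ℝ} {AL : Matrix N L ℝ} {AV : Matrix N V ℝ}
  {Am : Matrix N F ℝ} (sp : NodeSplitting AC AR AL AV Am)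

namespace NodeSplitting

lemma AV_TV (x : V → ℝ) : (AVᵀ * sp.TV) *ᵥ x = x :=
  eq_of_forall_dotProduct_eq fun z => by
    rw [dotProduct_mulVec_eq, transpose_mul, transpose_transpose, ← mulVec_mulVec, sp.TV_AV]

lemma PV_mulVec (e : N → ℝ) : sp.PV *ᵥ e = e - sp.TV *ᵥ (AVᵀ *ᵥ e) := by
  have := congrArg (· *ᵥ e) sp.split_V
  simp only [add_mulVec, one_mulVec, ← mulVec_mulVec] at this
  rw [eq_sub_iff_add_eq, add_comm, this]

lemma PC_mulVec (e : N → ℝ) : sp.PC *ᵥ e = sp.PV *ᵥ e - sp.TC *ᵥ (ACᵀ *ᵥ (sp.PV *ᵥ e)) := by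
  have := congrArg (· *ᵥ e) sp.split_C
  simp only [add_mulVec, ← mulVec_mulVec] at this
  rw [eq_sub_iff_add_eq, add_comm, this]

lemma PR_mulVec (e : N → ℝ) : sp.PR *ᵥ e = sp.PC *ᵥ e - sp.TR *ᵥ (ARᵀ *ᵥ (sp.PC *ᵥ e)) := by
  have := congrArg (· *ᵥ e) sp.split_R
  simp only [add_mulVec, ← mulVec_mulVec] at this
  rw [eq_sub_iff_add_eq, add_comm, this]

lemma TL_PR (e : N → ℝ) : sp.TL *ᵥ (ALᵀ *ᵥ (sp.PR *ᵥ e)) = sp.PR *ᵥ e := by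
  have := congrArg (· *ᵥ e) sp.split_L
  simpa only [← mulVec_mulVec] using this

lemma TR_AR (z : N → ℝ) :
    ARᵀ *ᵥ (sp.TR *ᵥ (ARᵀ *ᵥ (sp.PC *ᵥ z))) = ARᵀ *ᵥ (sp.PC *ᵥ z) := by
  have h := congrArg (ARᵀ *ᵥ ·) (sp.PR_mulVec z)
  simp only [mulVec_sub] at h
  rw [mulVec_mulVec, sp.AR_PR, zero_mulVec] at h
  exact (sub_eq_zero.1 h.symm).symm

lemma TC_AC (z : N → ℝ) :
    ACᵀ *ᵥ (sp.TC *ᵥ (ACᵀ *ᵥ (sp.PV *ᵥ z))) = ACᵀ *ᵥ (sp.PV *ᵥ z) := by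
  have h := congrArg (ACᵀ *ᵥ ·) (sp.PC_mulVec z)
  simp only [mulVec_sub] at h
  rw [mulVec_mulVec, sp.AC_PC, zero_mulVec] at h
  exact (sub_eq_zero.1 h.symm).symm

lemma dotProduct_TR_transpose {r : N → ℝ} (hr : ∀ z, (sp.PR *ᵥ z) ⬝ᵥ r = 0) (z : N → ℝ) :
    (ARᵀ *ᵥ (sp.PC *ᵥ z)) ⬝ᵥ (sp.TRᵀ *ᵥ r) = (sp.PC *ᵥ z) ⬝ᵥ r := by
  have h := hr z
  rw [sp.PR_mulVec, sub_dotProduct, sub_eq_zero] at h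
  rw [dotProduct_mulVec_eq, transpose_transpose, h]

lemma dotProduct_TC_transpose {r : N → ℝ} (hr : ∀ z, (sp.PC *ᵥ z) ⬝ᵥ r = 0) (z : N → ℝ) :
    (ACᵀ *ᵥ (sp.PV *ᵥ z)) ⬝ᵥ (sp.TCᵀ *ᵥ r) = (sp.PV *ᵥ z) ⬝ᵥ r := by
  have h := hr z
  rw [sp.PC_mulVec, sub_dotProduct, sub_eq_zero] at h
  rw [dotProduct_mulVec_eq, transpose_transpose, h]

lemma AV_TV_transpose {r : N → ℝ} (hr : ∀ z, (sp.PV *ᵥ z) ⬝ᵥ r = 0) :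
    AV *ᵥ (sp.TVᵀ *ᵥ r) = r :=
  eq_of_forall_dotProduct_eq fun z => by
    have h := hr z
    rw [sp.PV_mulVec, sub_dotProduct, sub_eq_zero] at h
    rw [dotProduct_mulVec_eq, dotProduct_mulVec_eq, transpose_transpose, h]

lemma PR_AL_TL_transpose (y : N → ℝ) :
    sp.PRᵀ *ᵥ (AL *ᵥ (sp.TLᵀ *ᵥ y)) = sp.PRᵀ *ᵥ y := by
  have h := congrArg Matrix.transpose sp.split_L
  simp only [transpose_mul, transpose_transpose] at h
  rw [mulVec_mulVec, mulVec_mulVec, Matrix.mul_assoc, h]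

/-- The voltages of the capacitors that node potentials without voltage on the voltage sources can
generate; the derivative of the capacitor voltages is known up to this space. -/
def capacitorSpace : Submodule ℝ (C → ℝ) := LinearMap.range (ACᵀ * sp.PV).mulVecLin

/-- The voltages of the resistors that node potentials without voltage on voltage sources and
capacitors can generate. -/
def resistorSpace : Submodule ℝ (R → ℝ) := LinearMap.range (ARᵀ * sp.PC).mulVecLin

/-- The inductor currents that satisfy Kirchhoff's current law in the cutsets formed by inductors and
current sources, with the current sources switched off. -/
def inductorSpace : Submodule ℝ (L → ℝ) := LinearMap.ker (sp.PRᵀ * AL).mulVecLin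

lemma mem_capacitorSpace {s : C → ℝ} :
    s ∈ sp.capacitorSpace ↔ ∃ z, ACᵀ *ᵥ (sp.PV *ᵥ z) = s := by
  simp only [capacitorSpace, LinearMap.mem_range, mulVecLin_apply, mulVec_mulVec]

lemma mem_resistorSpace {s : R → ℝ} :
    s ∈ sp.resistorSpace ↔ ∃ z, ARᵀ *ᵥ (sp.PC *ᵥ z) = s := by
  simp only [resistorSpace, LinearMap.mem_range, mulVecLin_apply, mulVec_mulVec]

lemma mem_inductorSpace {s : L → ℝ} : s ∈ sp.inductorSpace ↔ sp.PRᵀ *ᵥ (AL *ᵥ s) = 0 := by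
  simp only [inductorSpace, LinearMap.mem_ker, mulVecLin_apply, mulVec_mulVec]

lemma AL_TL_of_orthogonal {ρ : L → ℝ} (hρ : ∀ s ∈ sp.inductorSpace, s ⬝ᵥ ρ = 0) :
    ALᵀ *ᵥ (sp.TL *ᵥ ρ) = ρ :=
  eq_of_forall_dotProduct_eq fun z => by
    have h := hρ (z - sp.TLᵀ *ᵥ (AL *ᵥ z)) (by
      rw [mem_inductorSpace, mulVec_sub, mulVec_sub, PR_AL_TL_transpose, sub_self])
    rw [sub_dotProduct, sub_eq_zero] at h
    rw [dotProduct_mulVec_eq, dotProduct_mulVec_eq, transpose_transpose, h]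

end NodeSplitting

/-- The staged elimination of the circuit unknowns at a fixed time, for given values `qv`, `qv'`,
`qi`, `qi'` of the sources and their derivatives, capacitor voltages `u`, inductor currents `j` and
field currents `im`. The derivatives of `u` and `j` are `A_Cᵀ T_V qv' + sC` and `-T_Lᵀ qi' + sL`;
each of `sR`, `sC` and `sL` solves a Galerkin equation. -/
structure NodeSplitting.Staged [Fintype F] (cap : (C → ℝ) → Matrix C C ℝ) (g : (R → ℝ) → (R → ℝ))
    (ind : (L → ℝ) → Matrix L L ℝ) (qv qv' : V → ℝ) (qi qi' : N → ℝ) (u : C → ℝ) (j : L → ℝ)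
    (im : F → ℝ) (e₁ r e₂ r₂ : N → ℝ) (sR : R → ℝ) (sC : C → ℝ) (sL : L → ℝ) : Prop where
  e₁_eq : e₁ = sp.TV *ᵥ qv + sp.TC *ᵥ (u - ACᵀ *ᵥ (sp.TV *ᵥ qv))
  r_eq : r = AL *ᵥ j + qi - Am *ᵥ im
  sR_mem : sR ∈ sp.resistorSpace
  sR_orth : ∀ s ∈ sp.resistorSpace, s ⬝ᵥ (g (ARᵀ *ᵥ e₁ + sR) + sp.TRᵀ *ᵥ r) = 0
  e₂_eq : e₂ = e₁ + sp.TR *ᵥ sR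
  r₂_eq : r₂ = AR *ᵥ g (ARᵀ *ᵥ e₂) + r
  sC_mem : sC ∈ sp.capacitorSpace
  sC_orth : ∀ s ∈ sp.capacitorSpace,
    s ⬝ᵥ (cap u *ᵥ (ACᵀ *ᵥ (sp.TV *ᵥ qv') + sC) + sp.TCᵀ *ᵥ r₂) = 0
  sL_mem : sL ∈ sp.inductorSpace
  sL_orth : ∀ s ∈ sp.inductorSpace,
    s ⬝ᵥ (ind j *ᵥ (-(sp.TLᵀ *ᵥ qi') + sL) + -(ALᵀ *ᵥ e₂)) = 0

variable [Fintype F] {sp} {cap : (C → ℝ) → Matrix C C ℝ} {g : (R → ℝ) → (R → ℝ)}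
  {ind : (L → ℝ) → Matrix L L ℝ} {qv qv' iV : V → ℝ} {qi qi' : N → ℝ} {u du : C → ℝ}
  {j dj : L → ℝ} {im : F → ℝ}

/-- Solutions of the circuit equations solve the staged equations. -/
theorem NodeSplitting.Staged.of_solution {e e₁ r e₂ r₂ : N → ℝ} (hu : ACᵀ *ᵥ e = u)
    (hqv : AVᵀ *ᵥ e = qv)
    (hKCL : AC *ᵥ (cap u *ᵥ du) + (AR *ᵥ g (ARᵀ *ᵥ e) + AL *ᵥ j + AV *ᵥ iV + qi) = Am *ᵥ im)
    (hind : ind j *ᵥ dj = ALᵀ *ᵥ e) (hdu : du - ACᵀ *ᵥ (sp.TV *ᵥ qv') ∈ sp.capacitorSpace)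
    (hdj : sp.PRᵀ *ᵥ (AL *ᵥ dj + qi') = 0) (he₁ : e₁ = e - sp.PC *ᵥ e)
    (hr : r = AL *ᵥ j + qi - Am *ᵥ im) (he₂ : e₂ = e - sp.PR *ᵥ e)
    (hr₂ : r₂ = AR *ᵥ g (ARᵀ *ᵥ e) + r) :
    sp.Staged cap g ind qv qv' qi qi' u j im e₁ r e₂ r₂ (ARᵀ *ᵥ (sp.PC *ᵥ e))
        (du - ACᵀ *ᵥ (sp.TV *ᵥ qv')) (dj + sp.TLᵀ *ᵥ qi') ∧
      e = e₂ + sp.TL *ᵥ (ind j *ᵥ dj - ALᵀ *ᵥ e₂) ∧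
      iV = sp.TVᵀ *ᵥ (Am *ᵥ im - AC *ᵥ (cap u *ᵥ du) - AR *ᵥ g (ARᵀ *ᵥ e₂) - AL *ᵥ j - qi) := by
  have hKCL' : AC *ᵥ (cap u *ᵥ du) + AR *ᵥ g (ARᵀ *ᵥ e) + AV *ᵥ iV + r = 0 := by
    rw [hr, ← hKCL]; abel
  have hPR : ∀ z, (sp.PR *ᵥ z) ⬝ᵥ r = 0 := fun z => by
    have h := congrArg ((sp.PR *ᵥ z) ⬝ᵥ ·) hKCL'
    simpa only [dotProduct_add, dotProduct_mulVec_of_mul_eq_zero sp.AC_PR,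
      dotProduct_mulVec_of_mul_eq_zero sp.AR_PR, dotProduct_mulVec_of_mul_eq_zero sp.AV_PR,
      zero_add, dotProduct_zero] using h
  have hPC : ∀ z, (sp.PC *ᵥ z) ⬝ᵥ r₂ = 0 := fun z => by
    have h := congrArg ((sp.PC *ᵥ z) ⬝ᵥ ·) hKCL'
    simpa only [hr₂, dotProduct_add, dotProduct_mulVec_of_mul_eq_zero sp.AC_PC,
      dotProduct_mulVec_of_mul_eq_zero sp.AV_PC, zero_add, add_zero, dotProduct_zero] using h
  have hAR : ARᵀ *ᵥ e₂ = ARᵀ *ᵥ e := by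
    rw [he₂, mulVec_sub, mulVec_mulVec, sp.AR_PR, zero_mulVec, sub_zero]
  have hAL : ind j *ᵥ dj - ALᵀ *ᵥ e₂ = ALᵀ *ᵥ (sp.PR *ᵥ e) := by
    rw [hind, ← mulVec_sub, he₂, sub_sub_cancel]
  refine ⟨⟨?_, hr, sp.mem_resistorSpace.2 ⟨e, rfl⟩, fun s hs => ?_, ?_, by rw [hAR, hr₂], hdu,
    fun s hs => ?_, ?_, fun s hs => ?_⟩, ?_, ?_⟩
  · rw [he₁, sp.PC_mulVec, sp.PV_mulVec, ← hu, ← hqv, mulVec_sub]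
    abel
  · obtain ⟨z, rfl⟩ := sp.mem_resistorSpace.1 hs
    rw [dotProduct_add, sp.dotProduct_TR_transpose hPR, he₁, mulVec_sub, sub_add_cancel,
      ← hPC z, hr₂, dotProduct_add, dotProduct_mulVec_eq AR]
  · rw [he₂, he₁, sp.PR_mulVec]
    abel
  · obtain ⟨z, rfl⟩ := sp.mem_capacitorSpace.1 hs
    have h := congrArg ((sp.PV *ᵥ z) ⬝ᵥ ·) hKCL'
    simp only [dotProduct_add, dotProduct_mulVec_of_mul_eq_zero sp.AV_PV, dotProduct_zero] at h
    rw [dotProduct_add, sp.dotProduct_TC_transpose hPC, add_sub_cancel, ← dotProduct_mulVec_eq AC,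
      ← h, hr₂, dotProduct_add]
    ring
  · rw [sp.mem_inductorSpace, mulVec_add, mulVec_add, sp.PR_AL_TL_transpose, ← mulVec_add, hdj]
  · rw [add_comm dj, neg_add_cancel_left, ← sub_eq_add_neg, hAL, dotProduct_mulVec_eq,
      transpose_transpose, dotProduct_mulVec_eq, sp.mem_inductorSpace.1 hs, zero_dotProduct]
  · rw [hAL, sp.TL_PR, he₂, sub_add_cancel]
  · rw [hAR, ← hKCL, ← sp.TV_AV iV]
    congr 1
    rw [sp.TV_AV iV]
    abel

/-- Solutions of the staged equations solve the circuit equations if the capacitor voltages and the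
inductor currents satisfy the constraints imposed by the sources. -/
theorem NodeSplitting.Staged.solution {e e₁ r e₂ r₂ : N → ℝ} {sR : R → ℝ} {sC : C → ℝ}
    {sL : L → ℝ} (h : sp.Staged cap g ind qv qv' qi qi' u j im e₁ r e₂ r₂ sR sC sL)
    (hu : ACᵀ *ᵥ (sp.TC *ᵥ (u - ACᵀ *ᵥ (sp.TV *ᵥ qv))) = u - ACᵀ *ᵥ (sp.TV *ᵥ qv))
    (hj : sp.PRᵀ *ᵥ (AL *ᵥ j + qi) = 0) (hdu : du = ACᵀ *ᵥ (sp.TV *ᵥ qv') + sC)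
    (hdj : dj = -(sp.TLᵀ *ᵥ qi') + sL) (he : e = e₂ + sp.TL *ᵥ (ind j *ᵥ dj - ALᵀ *ᵥ e₂))
    (hiV : iV = sp.TVᵀ *ᵥ
      (Am *ᵥ im - AC *ᵥ (cap u *ᵥ du) - AR *ᵥ g (ARᵀ *ᵥ e₂) - AL *ᵥ j - qi)) :
    ACᵀ *ᵥ e = u ∧
      AC *ᵥ (cap u *ᵥ du) + (AR *ᵥ g (ARᵀ *ᵥ e) + AL *ᵥ j + AV *ᵥ iV + qi) = Am *ᵥ im ∧
      ind j *ᵥ dj = ALᵀ *ᵥ e ∧ AVᵀ *ᵥ e = qv ∧ Amᵀ *ᵥ e = Amᵀ *ᵥ e₂ := by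
  have hPR : ∀ z, (sp.PR *ᵥ z) ⬝ᵥ r = 0 := fun z => by
    rw [h.r_eq, ← transpose_transpose sp.PR, ← dotProduct_mulVec_eq, mulVec_sub, hj,
      transpose_mulVec_of_mul_eq_zero sp.Am_PR, sub_zero, dotProduct_zero]
  have hAR₂ : ARᵀ *ᵥ e₂ = ARᵀ *ᵥ e₁ + sR := by
    obtain ⟨z, hz⟩ := sp.mem_resistorSpace.1 h.sR_mem
    rw [h.e₂_eq, mulVec_add, ← hz, sp.TR_AR]
  have hPC : ∀ z, (sp.PC *ᵥ z) ⬝ᵥ r₂ = 0 := fun z => by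
    have h1 := h.sR_orth _ (sp.mem_resistorSpace.2 ⟨z, rfl⟩)
    rw [dotProduct_add, sp.dotProduct_TR_transpose hPR, ← hAR₂] at h1
    rw [h.r₂_eq, dotProduct_add, dotProduct_mulVec_eq AR, h1]
  have hAR : ARᵀ *ᵥ e = ARᵀ *ᵥ e₂ := by
    rw [he, mulVec_add, mulVec_mulVec, sp.AR_TL, zero_mulVec, add_zero]
  have hAL : ALᵀ *ᵥ (sp.TL *ᵥ (ind j *ᵥ dj - ALᵀ *ᵥ e₂)) = ind j *ᵥ dj - ALᵀ *ᵥ e₂ :=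
    sp.AL_TL_of_orthogonal fun s hs => by
      rw [hdj, sub_eq_add_neg]
      exact h.sL_orth s hs
  refine ⟨?_, ?_, ?_, ?_, ?_⟩
  · rw [he, h.e₂_eq, h.e₁_eq]
    simp only [mulVec_add, mulVec_mulVec _ ACᵀ sp.TL, mulVec_mulVec _ ACᵀ sp.TR, sp.AC_TL,
      sp.AC_TR, zero_mulVec, add_zero]
    rw [hu, add_sub_cancel]
  · have hw : AV *ᵥ iV =
        Am *ᵥ im - AC *ᵥ (cap u *ᵥ du) - AR *ᵥ g (ARᵀ *ᵥ e₂) - AL *ᵥ j - qi := by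
      rw [hiV]
      refine sp.AV_TV_transpose fun z => ?_
      have h1 := h.sC_orth _ (sp.mem_capacitorSpace.2 ⟨z, rfl⟩)
      rw [← hdu, dotProduct_add, sp.dotProduct_TC_transpose hPC, ← dotProduct_mulVec_eq AC,
        ← dotProduct_add, ← neg_eq_zero, ← dotProduct_neg] at h1
      rw [← h1, h.r₂_eq, h.r_eq]
      congr 1
      abel
    rw [hw, hAR]
    abel
  · rw [he, mulVec_add, hAL, add_sub_cancel]
  · rw [he, h.e₂_eq, h.e₁_eq]
    simp only [mulVec_add, mulVec_mulVec, sp.AV_TL, sp.AV_TR, sp.AV_TC, zero_mulVec, add_zero]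
    exact sp.AV_TV qv
  · rw [he, mulVec_add, mulVec_mulVec, sp.Am_TL, zero_mulVec, add_zero]

end Splitting

section Circuit

variable {N C R L V F : Type*} [Fintype N] [DecidableEq N] [Fintype C] [Fintype R] [Fintype L]
  [Fintype V] [Fintype F]

/-- The circuit system with input `i_m` is equivalent to an ordinary differential equation for
`(u, j) = (A_Cᵀ e, i_L)` with tame right hand side on the set of those `(u, j)` that satisfy the
constraint `Inv` at the initial time. The output `v_c` is a tame function of `(u, j, i_m)`, in
contrast to `e`, whose growth may be quadratic. -/
theorem Circuit.exists_reduction {ci : Circuit N C R L V F} {t₀ T : ℝ} (hT : t₀ < T)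
    (hci : ci.Admissible t₀ T) (hCVR : ∀ m, ci.HasParallelCVRPath m) :
    ∃ (f : ℝ → ((C → ℝ) × (L → ℝ)) × (F → ℝ) → (C → ℝ) × (L → ℝ))
      (χ : ℝ → ((C → ℝ) × (L → ℝ)) × (F → ℝ) → CircuitState N L V)
      (w : ℝ → ((C → ℝ) × (L → ℝ)) × (F → ℝ) → F → ℝ) (Inv : (C → ℝ) × (L → ℝ) → Prop),
      TameOn (Icc t₀ T) f ∧ TameOn (Icc t₀ T) w ∧
      ContinuousOn (fun q : ℝ × (((C → ℝ) × (L → ℝ)) × (F → ℝ)) => χ q.1 q.2)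
        (Icc t₀ T ×ˢ univ) ∧
      (∀ (T' : ℝ) (x : ℝ → CircuitState N L V) (vc im : ℝ → F → ℝ), t₀ < T' → T' ≤ T →
        ci.IsSolution t₀ T' x vc im → Inv (ci.ACᵀ *ᵥ (x t₀).1, (x t₀).2.1) ∧
        ∀ t ∈ Icc t₀ T',
          HasDerivWithinAt (fun s => (ci.ACᵀ *ᵥ (x s).1, (x s).2.1))
            (f t ((ci.ACᵀ *ᵥ (x t).1, (x t).2.1), im t)) (Icc t₀ T') t ∧
          x t = χ t ((ci.ACᵀ *ᵥ (x t).1, (x t).2.1), im t) ∧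
          vc t = w t ((ci.ACᵀ *ᵥ (x t).1, (x t).2.1), im t)) ∧
      ∀ (y : ℝ → (C → ℝ) × (L → ℝ)) (im : ℝ → F → ℝ), ContinuousOn im (Icc t₀ T) →
        Inv (y t₀) → (∀ t ∈ Icc t₀ T, HasDerivWithinAt y (f t (y t, im t)) (Icc t₀ T) t) →
        ci.IsSolution t₀ T (fun t => χ t (y t, im t)) (fun t => w t (y t, im t)) im := by
  have hI : IsCompact (Icc t₀ T) := isCompact_Icc
  have huniq := uniqueDiffOn_Icc hT
  obtain ⟨sp⟩ := NodeSplitting.nonempty (Am := ci.Am) hci.fullColumnRank_AV hci.fullRowRank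
    fun e hC hV hR => ci.Am_transpose_mulVec_eq_zero hCVR hC hV hR
  -- the derivatives of the source functions
  obtain ⟨qv', hqv'c, hqv'⟩ : ∃ q' : ℝ → V → ℝ, ContinuousOn q' (Icc t₀ T) ∧
      ∀ t ∈ Icc t₀ T, HasDerivWithinAt ci.qv (q' t) (Icc t₀ T) t :=
    ⟨_, hci.contDiff_qv.continuousOn_derivWithin huniq le_rfl, fun t ht =>
      ((hci.contDiff_qv.differentiableOn one_ne_zero) t ht).hasDerivWithinAt⟩
  obtain ⟨qi', hqi'c, hqi'⟩ : ∃ q' : ℝ → N → ℝ, ContinuousOn q' (Icc t₀ T) ∧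
      ∀ t ∈ Icc t₀ T, HasDerivWithinAt ci.qi (q' t) (Icc t₀ T) t :=
    ⟨_, hci.contDiff_qi.continuousOn_derivWithin huniq le_rfl, fun t ht =>
      ((hci.contDiff_qi.differentiableOn one_ne_zero) t ht).hasDerivWithinAt⟩
  -- the staged elimination as functions of the time and of `p = ((u, j), im)`
  let u : ℝ → ((C → ℝ) × (L → ℝ)) × (F → ℝ) → C → ℝ := fun _ p => p.1.1
  let j : ℝ → ((C → ℝ) × (L → ℝ)) × (F → ℝ) → L → ℝ := fun _ p => p.1.2
  let im : ℝ → ((C → ℝ) × (L → ℝ)) × (F → ℝ) → F → ℝ := fun _ p => p.2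
  have hu : TameOn (Icc t₀ T) u := TameOn.clm
    ((ContinuousLinearMap.fst ℝ (C → ℝ) (L → ℝ)).comp (ContinuousLinearMap.fst ℝ _ (F → ℝ)))
  have hj : TameOn (Icc t₀ T) j := TameOn.clm
    ((ContinuousLinearMap.snd ℝ (C → ℝ) (L → ℝ)).comp (ContinuousLinearMap.fst ℝ _ (F → ℝ)))
  have him : TameOn (Icc t₀ T) im := TameOn.clm
    (ContinuousLinearMap.snd ℝ ((C → ℝ) × (L → ℝ)) (F → ℝ))
  have hqv : TameOn (Icc t₀ T) (fun t (_ : ((C → ℝ) × (L → ℝ)) × (F → ℝ)) => ci.qv t) :=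
    TameOn.of_continuousOn hI hci.contDiff_qv.continuousOn
  have hqi : TameOn (Icc t₀ T) (fun t (_ : ((C → ℝ) × (L → ℝ)) × (F → ℝ)) => ci.qi t) :=
    TameOn.of_continuousOn hI hci.contDiff_qi.continuousOn
  have hdqv : TameOn (Icc t₀ T) (fun t (_ : ((C → ℝ) × (L → ℝ)) × (F → ℝ)) => qv' t) :=
    TameOn.of_continuousOn hI hqv'c
  have hdqi : TameOn (Icc t₀ T) (fun t (_ : ((C → ℝ) × (L → ℝ)) × (F → ℝ)) => qi' t) :=
    TameOn.of_continuousOn hI hqi'c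
  obtain ⟨e₁, he₁⟩ : ∃ e : ℝ → ((C → ℝ) × (L → ℝ)) × (F → ℝ) → N → ℝ, e = fun t p =>
    sp.TV *ᵥ ci.qv t + sp.TC *ᵥ (u t p - ci.ACᵀ *ᵥ (sp.TV *ᵥ ci.qv t)) := ⟨_, rfl⟩
  have he₁t : TameOn (Icc t₀ T) e₁ := by
    rw [he₁]
    exact (hqv.mulVec _).add ((hu.sub ((hqv.mulVec _).mulVec _)).mulVec _)
  obtain ⟨r, hr⟩ : ∃ r : ℝ → ((C → ℝ) × (L → ℝ)) × (F → ℝ) → N → ℝ, r = fun t p =>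
    ci.AL *ᵥ j t p + ci.qi t - ci.Am *ᵥ im t p := ⟨_, rfl⟩
  have hrt : TameOn (Icc t₀ T) r := by
    rw [hr]
    exact ((hj.mulVec _).add hqi).sub (him.mulVec _)
  obtain ⟨GR, ⟨kR, hGR⟩, hGRmem, hGRorth, hGRuniq⟩ :=
    exists_lipschitz_galerkin hci.stronglyMonotone_g hci.lipschitz_g sp.resistorSpace
  obtain ⟨sR, hsR⟩ : ∃ s : ℝ → ((C → ℝ) × (L → ℝ)) × (F → ℝ) → R → ℝ, s = fun t p =>
    GR (ci.ARᵀ *ᵥ e₁ t p, sp.TRᵀ *ᵥ r t p) := ⟨_, rfl⟩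
  have hsRt : TameOn (Icc t₀ T) sR := by
    rw [hsR]
    exact ((he₁t.mulVec _).prodMk (hrt.mulVec _)).lipschitz_comp hGR
  obtain ⟨e₂, he₂⟩ : ∃ e : ℝ → ((C → ℝ) × (L → ℝ)) × (F → ℝ) → N → ℝ, e = fun t p =>
    e₁ t p + sp.TR *ᵥ sR t p := ⟨_, rfl⟩
  have he₂t : TameOn (Icc t₀ T) e₂ := by
    rw [he₂]
    exact he₁t.add (hsRt.mulVec _)
  obtain ⟨kg, hkg⟩ := hci.lipschitz_g
  obtain ⟨γ, hγ⟩ : ∃ γ : ℝ → ((C → ℝ) × (L → ℝ)) × (F → ℝ) → N → ℝ, γ = fun t p =>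
    ci.AR *ᵥ ci.g (ci.ARᵀ *ᵥ e₂ t p) := ⟨_, rfl⟩
  have hγt : TameOn (Icc t₀ T) γ := by
    rw [hγ]
    exact ((he₂t.mulVec _).lipschitz_comp hkg).mulVec _
  obtain ⟨r₂, hr₂⟩ : ∃ r₂ : ℝ → ((C → ℝ) × (L → ℝ)) × (F → ℝ) → N → ℝ, r₂ = fun t p =>
    γ t p + r t p := ⟨_, rfl⟩
  have hr₂t : TameOn (Icc t₀ T) r₂ := by
    rw [hr₂]
    exact hγt.add hrt
  have hbC : TameOn (Icc t₀ T) (fun t (_ : ((C → ℝ) × (L → ℝ)) × (F → ℝ)) =>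
    ci.ACᵀ *ᵥ (sp.TV *ᵥ qv' t)) := (hdqv.mulVec _).mulVec _
  obtain ⟨sC, hsCt, hsCmem, hsCorth, hsCuniq⟩ := exists_tame_galerkin hI hci.lipschitz_cap
    hci.posDef_cap sp.capacitorSpace
    (hbC.continuousOn_comp (y := fun _ => 0) continuousOn_const) hu (hr₂t.mulVec sp.TCᵀ)
  have hbL : TameOn (Icc t₀ T) (fun t (_ : ((C → ℝ) × (L → ℝ)) × (F → ℝ)) =>
    -(sp.TLᵀ *ᵥ qi' t)) := (hdqi.mulVec _).clm_comp (-ContinuousLinearMap.id ℝ _)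
  obtain ⟨sL, hsLt, hsLmem, hsLorth, hsLuniq⟩ := exists_tame_galerkin hI hci.lipschitz_ind
    hci.posDef_ind sp.inductorSpace
    (hbL.continuousOn_comp (y := fun _ => 0) continuousOn_const) hj
    ((he₂t.mulVec ci.ALᵀ).clm_comp (-ContinuousLinearMap.id ℝ _))
  obtain ⟨du, hdu⟩ : ∃ d : ℝ → ((C → ℝ) × (L → ℝ)) × (F → ℝ) → C → ℝ, d = fun t p =>
    ci.ACᵀ *ᵥ (sp.TV *ᵥ qv' t) + sC t p := ⟨_, rfl⟩
  have hdut : TameOn (Icc t₀ T) du := by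
    rw [hdu]
    exact hbC.add hsCt
  obtain ⟨dj, hdj⟩ : ∃ d : ℝ → ((C → ℝ) × (L → ℝ)) × (F → ℝ) → L → ℝ, d = fun t p =>
    -(sp.TLᵀ *ᵥ qi' t) + sL t p := ⟨_, rfl⟩
  have hdjt : TameOn (Icc t₀ T) dj := by
    rw [hdj]
    exact hbL.add hsLt
  have hstaged : ∀ t p, sp.Staged ci.cap ci.g ci.ind (ci.qv t) (qv' t) (ci.qi t) (qi' t) (u t p)
      (j t p) (im t p) (e₁ t p) (r t p) (e₂ t p) (r₂ t p) (sR t p) (sC t p) (sL t p) := by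
    intro t p
    refine ⟨by rw [he₁], by rw [hr], by rw [hsR]; exact hGRmem _, ?_, by rw [he₂],
      by rw [hr₂, hγ], hsCmem t p, hsCorth t p, hsLmem t p, hsLorth t p⟩
    rw [hsR]
    exact hGRorth (ci.ARᵀ *ᵥ e₁ t p, sp.TRᵀ *ᵥ r t p)
  obtain ⟨e, he⟩ : ∃ e : ℝ → ((C → ℝ) × (L → ℝ)) × (F → ℝ) → N → ℝ, e = fun t p =>
    e₂ t p + sp.TL *ᵥ (ci.ind (j t p) *ᵥ dj t p - ci.ALᵀ *ᵥ e₂ t p) := ⟨_, rfl⟩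
  obtain ⟨iV, hiV⟩ : ∃ i : ℝ → ((C → ℝ) × (L → ℝ)) × (F → ℝ) → V → ℝ, i = fun t p =>
    sp.TVᵀ *ᵥ (ci.Am *ᵥ im t p - ci.AC *ᵥ (ci.cap (u t p) *ᵥ du t p)
      - ci.AR *ᵥ ci.g (ci.ARᵀ *ᵥ e₂ t p) - ci.AL *ᵥ j t p - ci.qi t) := ⟨_, rfl⟩
  obtain ⟨w, hw⟩ : ∃ w : ℝ → ((C → ℝ) × (L → ℝ)) × (F → ℝ) → F → ℝ, w = fun t p =>
    ci.Amᵀ *ᵥ e₂ t p := ⟨_, rfl⟩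
  have hec : ContinuousOn (fun q : ℝ × (((C → ℝ) × (L → ℝ)) × (F → ℝ)) => e q.1 q.2)
      (Icc t₀ T ×ˢ univ) := by
    rw [he]
    exact he₂t.cont.add (ContinuousOn.mulVec _ (ContinuousOn.sub
      (hci.lipschitz_ind.continuous_mulVec.comp_continuousOn (hj.cont.prodMk hdjt.cont))
      (ContinuousOn.mulVec _ he₂t.cont)))
  have hiVc : ContinuousOn (fun q : ℝ × (((C → ℝ) × (L → ℝ)) × (F → ℝ)) => iV q.1 q.2)
      (Icc t₀ T ×ˢ univ) := by
    have h := ((((him.mulVec ci.Am).cont.sub (ContinuousOn.mulVec ci.AC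
      (hci.lipschitz_cap.continuous_mulVec.comp_continuousOn (hu.cont.prodMk hdut.cont)))).sub
      hγt.cont).sub (hj.mulVec ci.AL).cont).sub hqi.cont
    rw [hγ] at h
    rw [hiV]
    exact ContinuousOn.mulVec _ h
  refine ⟨fun t p => (du t p, dj t p), fun t p => (e t p, j t p, iV t p), w,
    fun y => ci.ACᵀ *ᵥ (sp.TC *ᵥ (y.1 - ci.ACᵀ *ᵥ (sp.TV *ᵥ ci.qv t₀))) =
      y.1 - ci.ACᵀ *ᵥ (sp.TV *ᵥ ci.qv t₀) ∧ sp.PRᵀ *ᵥ (ci.AL *ᵥ y.2 + ci.qi t₀) = 0,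
    hdut.prodMk hdjt, by rw [hw]; exact he₂t.mulVec _, hec.prodMk (hj.cont.prodMk hiVc), ?_, ?_⟩
  · rintro T' x vc i ht₀ hT' ⟨_, _, du', dj', _, _, hsol⟩
    have hsub : Icc t₀ T' ⊆ Icc t₀ T := Icc_subset_Icc_right hT'
    have hmem : t₀ ∈ Icc t₀ T' := left_mem_Icc.2 ht₀.le
    have hqvx : ∀ t ∈ Icc t₀ T', ci.AVᵀ *ᵥ (x t).1 = ci.qv t := fun t ht =>
      sub_eq_zero.1 (hsol t ht).2.2.2.2.1
    -- the constraints on the states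
    have hinv₁ : ∀ t ∈ Icc t₀ T',
        ci.ACᵀ *ᵥ (x t).1 - ci.ACᵀ *ᵥ (sp.TV *ᵥ ci.qv t) = ci.ACᵀ *ᵥ (sp.PV *ᵥ (x t).1) :=
      fun t ht => by rw [← hqvx t ht, ← mulVec_sub, sp.PV_mulVec]
    have hinv₂ : ∀ t ∈ Icc t₀ T', sp.PRᵀ *ᵥ (ci.AL *ᵥ (x t).2.1 + ci.qi t) = 0 := fun t ht => by
      have h := congrArg (sp.PRᵀ *ᵥ ·) (hsol t ht).2.2.1
      simp only [mulVec_add, transpose_mulVec_of_mul_eq_zero sp.AC_PR,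
        transpose_mulVec_of_mul_eq_zero sp.AR_PR, transpose_mulVec_of_mul_eq_zero sp.AV_PR,
        transpose_mulVec_of_mul_eq_zero sp.Am_PR, zero_add, add_zero] at h
      rw [mulVec_add, h]
    refine ⟨⟨?_, hinv₂ t₀ hmem⟩, fun t ht => ?_⟩
    · rw [hinv₁ t₀ hmem, sp.TC_AC]
    obtain ⟨h1, h2, h3, h4, h5, h6⟩ := hsol t ht
    have huniq' := uniqueDiffOn_Icc ht₀ t ht
    -- the constraints on the derivatives of the states
    have hdu' : du' t - ci.ACᵀ *ᵥ (sp.TV *ᵥ qv' t) ∈ sp.capacitorSpace := by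
      have hD := h1.sub (hasDerivWithinAt_mulVec ci.ACᵀ (hasDerivWithinAt_mulVec sp.TV
        ((hqv' t (hsub ht)).mono hsub)))
      have hD' := hasDerivWithinAt_mulVec ci.ACᵀ (hasDerivWithinAt_mulVec sp.TC hD)
      have heq : ci.ACᵀ *ᵥ (sp.TC *ᵥ (du' t - ci.ACᵀ *ᵥ (sp.TV *ᵥ qv' t))) =
          du' t - ci.ACᵀ *ᵥ (sp.TV *ᵥ qv' t) := by
        refine huniq'.eq_deriv _ hD' (hD.congr_of_mem (fun s hs => ?_) ht)
        simp only [Pi.sub_apply]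
        rw [hinv₁ s hs, sp.TC_AC]
      refine sp.mem_capacitorSpace.2
        ⟨sp.TC *ᵥ (du' t - ci.ACᵀ *ᵥ (sp.TV *ᵥ qv' t)), Eq.trans ?_ heq⟩
      rw [sp.PV_mulVec, mulVec_mulVec _ ci.AVᵀ, sp.AV_TC, zero_mulVec, mulVec_zero, sub_zero]
    have hdj' : sp.PRᵀ *ᵥ (ci.AL *ᵥ dj' t + qi' t) = 0 := by
      have hD := hasDerivWithinAt_mulVec sp.PRᵀ ((hasDerivWithinAt_mulVec ci.AL h2).add
        ((hqi' t (hsub ht)).mono hsub))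
      exact huniq'.eq_deriv _ hD ((hasDerivWithinAt_const t (Icc t₀ T') (0 : N → ℝ)).congr_of_mem
        (fun s hs => hinv₂ s hs) ht)
    have hind : ci.ind (x t).2.1 *ᵥ dj' t = ci.ALᵀ *ᵥ (x t).1 := by
      rw [neg_add_eq_sub, sub_eq_zero] at h4
      exact h4.symm
    obtain ⟨H, hex, hiVx⟩ := NodeSplitting.Staged.of_solution (sp := sp) (cap := ci.cap)
      (g := ci.g) (ind := ci.ind) rfl (hqvx t ht) h3 hind hdu' hdj' rfl rfl rfl rfl
    obtain ⟨p, hp⟩ : ∃ p, p = ((ci.ACᵀ *ᵥ (x t).1, (x t).2.1), i t) := ⟨_, rfl⟩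
    rw [← hp]
    have hup : u t p = ci.ACᵀ *ᵥ (x t).1 := by rw [hp]
    have hjp : j t p = (x t).2.1 := by rw [hp]
    have hip : im t p = i t := by rw [hp]
    rw [← hup, ← hjp, ← hip] at H
    -- both staged solutions agree, stage by stage
    have E₁ : (x t).1 - sp.PC *ᵥ (x t).1 = e₁ t p := by rw [H.e₁_eq, he₁]
    rw [E₁] at H
    have hrp : r t p = ci.AL *ᵥ j t p + ci.qi t - ci.Am *ᵥ im t p := by rw [hr]
    rw [← hrp] at H
    have ER : ci.ARᵀ *ᵥ (sp.PC *ᵥ (x t).1) = sR t p := by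
      rw [hsR]
      exact hGRuniq (ci.ARᵀ *ᵥ e₁ t p, sp.TRᵀ *ᵥ r t p) _ H.sR_mem H.sR_orth
    rw [ER] at H
    have E₂ : (x t).1 - sp.PR *ᵥ (x t).1 = e₂ t p := by rw [H.e₂_eq, he₂]
    rw [E₂] at H
    have Er₂ : ci.AR *ᵥ ci.g (ci.ARᵀ *ᵥ (x t).1) + r t p = r₂ t p := by
      rw [H.r₂_eq, hr₂, hγ]
    rw [Er₂] at H
    have EC : du' t = du t p := by
      rw [hdu]
      simp only
      rw [← hsCuniq t p _ H.sC_mem H.sC_orth, add_sub_cancel]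
    have EL : dj' t = dj t p := by
      rw [hdj]
      simp only
      rw [← hsLuniq t p _ H.sL_mem H.sL_orth]
      abel
    have Ee : (x t).1 = e t p := by
      rw [E₂, EL, ← hjp] at hex
      rw [he]
      exact hex
    refine ⟨?_, ?_, ?_⟩
    · simp only
      rw [← EC, ← EL]
      exact h1.prodMk h2
    · rw [hiV]
      simp only
      rw [← Ee, hjp, hip, hup, ← EC, ← E₂, ← hiVx]
    · rw [hw]
      simp only
      rw [← sub_eq_zero.1 h6, ← E₂, mulVec_sub, mulVec_mulVec _ ci.Amᵀ, sp.Am_PR, zero_mulVec,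
        sub_zero]
  · intro y i hi hy₀ hy
    have hyc : ContinuousOn y (Icc t₀ T) := fun t ht => (hy t ht).continuousWithinAt
    have hpc : ContinuousOn (fun t => (y t, i t)) (Icc t₀ T) := hyc.prodMk hi
    have hpm : MapsTo (fun t => (t, (y t, i t))) (Icc t₀ T) (Icc t₀ T ×ˢ univ) :=
      fun t ht => ⟨ht, mem_univ _⟩
    have hy₁ : ∀ t ∈ Icc t₀ T,
        HasDerivWithinAt (fun s => (y s).1) (du t (y t, i t)) (Icc t₀ T) t := fun t ht =>
      (hasFDerivAt_fst (𝕜 := ℝ) (p := y t)).comp_hasDerivWithinAt t (hy t ht)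
    have hy₂ : ∀ t ∈ Icc t₀ T,
        HasDerivWithinAt (fun s => (y s).2) (dj t (y t, i t)) (Icc t₀ T) t := fun t ht =>
      (hasFDerivAt_snd (𝕜 := ℝ) (p := y t)).comp_hasDerivWithinAt t (hy t ht)
    -- the constraints on the states are preserved
    have hinv₁ : ∀ t ∈ Icc t₀ T,
        ci.ACᵀ *ᵥ (sp.TC *ᵥ ((y t).1 - ci.ACᵀ *ᵥ (sp.TV *ᵥ ci.qv t))) -
          ((y t).1 - ci.ACᵀ *ᵥ (sp.TV *ᵥ ci.qv t)) = 0 := by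
      refine eq_zero_of_hasDerivWithinAt_zero (fun t ht => ?_) (sub_eq_zero.2 hy₀.1)
      have hD := (hy₁ t ht).sub (hasDerivWithinAt_mulVec ci.ACᵀ (hasDerivWithinAt_mulVec sp.TV
        (hqv' t ht)))
      refine ((hasDerivWithinAt_mulVec ci.ACᵀ (hasDerivWithinAt_mulVec sp.TC hD)).sub
        hD).congr_deriv ?_
      obtain ⟨z, hz⟩ := sp.mem_capacitorSpace.1 (hsCmem t (y t, i t))
      rw [hdu]
      simp only
      rw [add_sub_cancel_left, ← hz, sp.TC_AC, sub_self]
    have hinv₂ : ∀ t ∈ Icc t₀ T, sp.PRᵀ *ᵥ (ci.AL *ᵥ (y t).2 + ci.qi t) = 0 := by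
      refine eq_zero_of_hasDerivWithinAt_zero (fun t ht => ?_) hy₀.2
      refine (hasDerivWithinAt_mulVec sp.PRᵀ ((hasDerivWithinAt_mulVec ci.AL (hy₂ t ht)).add
        (hqi' t ht))).congr_deriv ?_
      rw [hdj]
      simp only
      rw [mulVec_add, mulVec_add, mulVec_add, sp.mem_inductorSpace.1 (hsLmem t (y t, i t)),
        mulVec_neg, mulVec_neg, sp.PR_AL_TL_transpose, add_zero, neg_add_cancel]
    have hsol := fun t (ht : t ∈ Icc t₀ T) => (hstaged t (y t, i t)).solution
      (sub_eq_zero.1 (hinv₁ t ht)) (hinv₂ t ht)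
      (congrFun (congrFun hdu t) (y t, i t)) (congrFun (congrFun hdj t) (y t, i t))
      (congrFun (congrFun he t) (y t, i t)) (congrFun (congrFun hiV t) (y t, i t))
    refine ⟨(hec.comp (continuousOn_id.prodMk hpc) hpm).prodMk
        ((hyc.snd).prodMk (hiVc.comp (continuousOn_id.prodMk hpc) hpm)), ?_,
      fun t => du t (y t, i t), fun t => dj t (y t, i t), hdut.continuousOn_comp hpc,
      hdjt.continuousOn_comp hpc, fun t ht => ?_⟩
    · rw [hw]
      exact ContinuousOn.mulVec _ (he₂t.continuousOn_comp hpc)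
    obtain ⟨h1, h2, h3, h4, h5⟩ := hsol t ht
    refine ⟨(hy₁ t ht).congr_of_mem (fun s hs => (hsol s hs).1) ht, hy₂ t ht, ?_, ?_, ?_, ?_⟩
    · simp only
      rw [h1]
      exact h2
    · simp only
      rw [← h3, neg_add_cancel]
    · exact sub_eq_zero.2 h4
    · rw [hw]
      exact sub_eq_zero.2 h5

end Circuit

/-! ### The coupled system -/

/-- Uniform convergence is preserved by a time dependent continuous map on a proper space. -/
lemma tendstoUniformlyOn_comp_of_continuousOn {E G : Type*} [NormedAddCommGroup E] [ProperSpace E]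
    [PseudoMetricSpace G] {χ : ℝ → E → G} {I : Set ℝ} (hI : IsCompact I)
    (hχ : ContinuousOn (fun q : ℝ × E => χ q.1 q.2) (I ×ˢ univ)) {Y : ℕ → ℝ → E} {y : ℝ → E}
    (hy : ContinuousOn y I) {R : ℝ} (hR : ∀ k, ∀ t ∈ I, ‖Y k t‖ ≤ R)
    (hY : TendstoUniformlyOn Y y atTop I) :
    TendstoUniformlyOn (fun k t => χ t (Y k t)) (fun t => χ t (y t)) atTop I := by
  obtain ⟨R', hR'⟩ := hI.exists_bound_of_continuousOn hy
  have hu := (hI.prod (isCompact_closedBall (0 : E) (max R R'))).uniformContinuousOn_of_continuous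
    (hχ.mono (prod_mono le_rfl (subset_univ _)))
  rw [Metric.uniformContinuousOn_iff] at hu
  rw [Metric.tendstoUniformlyOn_iff] at hY ⊢
  intro ε hε
  obtain ⟨δ, hδ, h⟩ := hu ε hε
  filter_upwards [hY δ hδ] with k hk t ht
  refine h (t, y t) ⟨ht, ?_⟩ (t, Y k t) ⟨ht, ?_⟩ ?_
  · simpa using Or.inr (hR' t ht)
  · simpa using Or.inl (hR k t ht)
  · rw [Prod.dist_eq, dist_self]
    exact max_lt hδ (hk t ht)

section Coupled

variable {ι F N C R L V : Type*} [Fintype ι] [Fintype F] [Fintype N] [DecidableEq N] [Fintype C]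
  [Fintype R] [Fintype L] [Fintype V]

/-- The differential variables of the coupled system: `Xᵀ a` and `M a` of the field model, `A_Cᵀ e`
and `i_L` of the circuit. -/
abbrev DiffState (ι F C L : Type*) := ((F → ℝ) × (ι → ℝ)) × ((C → ℝ) × (L → ℝ))

/-- One step of the relaxation scheme, i.e. the field system with input `v` followed by the circuit
system with the resulting current, is equivalent to an ordinary differential equation with input
`v`. The initial value `y₀` of the differential variables determines the initial values of all
other unknowns, no matter what the input is; this is where consistency of the initial value
is used. -/
theorem exists_coupled_reduction {fm : FieldModel ι F} {ci : Circuit N C R L V F} {t₀ T : ℝ}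
    (hT : t₀ < T) (hfm : fm.Admissible) (hXM : fm.Xᵀ * fm.M = 0)
    (hK : IsLipschitz (fun a => fm.K a *ᵥ a)) (hci : ci.Admissible t₀ T)
    (hCVR : ∀ m, ci.HasParallelCVRPath m) {a₀ : ι → ℝ} {x₀ : CircuitState N L V}
    (h₀ : ConsistentInitialValue fm ci t₀ T a₀ x₀) :
    ∃ (f : ℝ → DiffState ι F C L × (F → ℝ) → DiffState ι F C L) (H : ℝ → DiffState ι F C L → F → ℝ)
      (χ : ℝ → DiffState ι F C L → State ι F N L V) (y₀ : DiffState ι F C L),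
      TameOn (Icc t₀ T) f ∧ TameOn (Icc t₀ T) H ∧
      ContinuousOn (fun q : ℝ × DiffState ι F C L => χ q.1 q.2) (Icc t₀ T ×ˢ univ) ∧
      (∀ t y, (χ t y).2.2.2 = H t y) ∧
      (∀ v z, SolvesWithInput fm ci t₀ T a₀ x₀ v z → ContinuousOn v (Icc t₀ T) ∧
        ∃ y, SolvesIVP (fun t y => f t (y, v t)) t₀ T y₀ y ∧ ∀ t ∈ Icc t₀ T, z t = χ t (y t)) ∧
      ∀ v y, ContinuousOn v (Icc t₀ T) → SolvesIVP (fun t y => f t (y, v t)) t₀ T y₀ y →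
        SolvesWithInput fm ci t₀ T a₀ x₀ v (fun t => χ t (y t)) := by
  obtain ⟨α, c, φ, ⟨kα, hα⟩, ⟨kc, hc⟩, ⟨kφ, hφ⟩, hffwd, hfbwd⟩ :=
    FieldModel.exists_reduction hfm hXM hK
  obtain ⟨f, χ, w, Inv, hf, hw, hχ, hcfwd, hcbwd⟩ := Circuit.exists_reduction hT hci hCVR
  have hfst : TameOn (Icc t₀ T) (fun _ (y : DiffState ι F C L) => y.1) :=
    TameOn.clm (ContinuousLinearMap.fst ℝ ((F → ℝ) × (ι → ℝ)) ((C → ℝ) × (L → ℝ)))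
  have hsnd : TameOn (Icc t₀ T) (fun _ (y : DiffState ι F C L) => y.2) :=
    TameOn.clm (ContinuousLinearMap.snd ℝ ((F → ℝ) × (ι → ℝ)) ((C → ℝ) × (L → ℝ)))
  have hcirc : TameOn (Icc t₀ T) (fun _ (y : DiffState ι F C L) => (y.2, c y.1)) :=
    hsnd.prodMk (hfst.lipschitz_comp hc)
  have hstate : TameOn (Icc t₀ T) (fun _ (p : DiffState ι F C L × (F → ℝ)) => p.1) :=
    TameOn.clm (ContinuousLinearMap.fst ℝ (DiffState ι F C L) (F → ℝ))
  have hinput : TameOn (Icc t₀ T) (fun _ (p : DiffState ι F C L × (F → ℝ)) => p.2) :=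
    TameOn.clm (ContinuousLinearMap.snd ℝ (DiffState ι F C L) (F → ℝ))
  -- the initial state computed from the short solution that consistency provides
  obtain ⟨T', hT', hT'T, z₀, ⟨hz₁, hz₂, hz₃, hz₄⟩⟩ := h₀
  have hmem' : t₀ ∈ Icc t₀ T' := left_mem_Icc.2 hT'.le
  have hmem : t₀ ∈ Icc t₀ T := left_mem_Icc.2 hT.le
  obtain ⟨-, ha₀, hi₀⟩ := hffwd t₀ T' _ _ _ hT' hz₁ t₀ hmem'
  obtain ⟨hInv, hx⟩ := hcfwd T' _ _ _ hT' hT'T hz₂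
  obtain ⟨-, hx₀, -⟩ := hx t₀ hmem'
  simp only [hz₃, hz₄] at ha₀ hi₀ hx₀ hInv
  rw [hi₀] at hx₀
  refine ⟨fun t p => ((p.2, φ p.1.1), f t (p.1.2, c p.1.1)), fun t y => w t (y.2, c y.1),
    fun t y => (α y.1, c y.1, χ t (y.2, c y.1), w t (y.2, c y.1)),
    ((fm.Xᵀ *ᵥ a₀, fm.M *ᵥ a₀), (ci.ACᵀ *ᵥ x₀.1, x₀.2.1)),
    (hinput.prodMk ((hfst.comp hstate).lipschitz_comp hφ)).prodMk (hf.comp (hcirc.comp hstate)),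
    hw.comp hcirc, ?_, fun _ _ => rfl, ?_, ?_⟩
  · refine (hfst.lipschitz_comp hα).cont.prodMk ((hfst.lipschitz_comp hc).cont.prodMk
      (ContinuousOn.prodMk ?_ (hw.comp hcirc).cont))
    exact hχ.comp (f := fun q : ℝ × DiffState ι F C L => (q.1, (q.2.2, c q.2.1)))
      (continuousOn_fst.prodMk hcirc.cont) fun q hq => ⟨hq.1, mem_univ _⟩
  · rintro v z ⟨h₁, h₂, h₃, h₄⟩
    have hv : ContinuousOn v (Icc t₀ T) := by
      obtain ⟨_, _, _, dXa, _, hdXa, h⟩ := h₁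
      exact hdXa.congr fun t ht => (h t ht).2.2.2.symm
    refine ⟨hv, fun t => ((fm.Xᵀ *ᵥ (z t).1, fm.M *ᵥ (z t).1),
      (ci.ACᵀ *ᵥ (z t).2.2.1.1, (z t).2.2.1.2.1)), ⟨?_, fun t ht => ?_⟩, fun t ht => ?_⟩
    · simp only [h₃, h₄]
    · obtain ⟨d₁, -, e₁⟩ := hffwd t₀ T _ _ _ hT h₁ t ht
      obtain ⟨d₂, -, -⟩ := (hcfwd T _ _ _ hT le_rfl h₂).2 t ht
      rw [e₁] at d₂
      exact d₁.prodMk d₂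
    · obtain ⟨-, e₁, e₂⟩ := hffwd t₀ T _ _ _ hT h₁ t ht
      obtain ⟨-, e₃, e₄⟩ := (hcfwd T _ _ _ hT le_rfl h₂).2 t ht
      rw [e₂] at e₃ e₄
      exact Prod.ext e₁ (Prod.ext e₂ (Prod.ext e₃ e₄))
  · rintro v y hv ⟨hy₀, hy⟩
    have d₁ : ∀ t ∈ Icc t₀ T,
        HasDerivWithinAt (fun t => (y t).1) (v t, φ (y t).1) (Icc t₀ T) t := fun t ht =>
      (hasFDerivAt_fst (𝕜 := ℝ) (p := y t)).comp_hasDerivWithinAt t (hy t ht)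
    have d₂ : ∀ t ∈ Icc t₀ T,
        HasDerivWithinAt (fun t => (y t).2) (f t ((y t).2, c (y t).1)) (Icc t₀ T) t :=
      fun t ht => (hasFDerivAt_snd (𝕜 := ℝ) (p := y t)).comp_hasDerivWithinAt t (hy t ht)
    have hyc : ContinuousOn (fun t => (y t).1) (Icc t₀ T) :=
      fun t ht => (d₁ t ht).continuousWithinAt
    refine ⟨hfbwd t₀ T _ v hv d₁, hcbwd _ _ (hc.continuous.comp_continuousOn hyc) ?_ d₂, ?_, ?_⟩
    · simp only [hy₀]
      exact hInv
    · simp only [hy₀]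
      exact ha₀.symm
    · simp only [hy₀]
      exact hx₀.symm

end Coupled

end FieldCircuit

theorem theorem1 {ι F N C R L V : Type*}
    [Fintype ι] [Fintype F] [Fintype N] [DecidableEq N] [Fintype C] [Fintype R] [Fintype L]
    [Fintype V]
    (fm : FieldCircuit.FieldModel ι F) (ci : FieldCircuit.Circuit N C R L V F)
    (t₀ T : ℝ) (hT : t₀ < T)
    (hfm : fm.Admissible)
    (hXM : fm.Xᵀ * fm.M = 0)
    (hK : FieldCircuit.IsLipschitz (fun a => fm.K a *ᵥ a))
    (hci : ci.Admissible t₀ T)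
    (hCVR : ∀ m : F, ci.HasParallelCVRPath m)
    (a₀ : ι → ℝ) (x₀ : FieldCircuit.CircuitState N L V)
    (h₀ : FieldCircuit.ConsistentInitialValue fm ci t₀ T a₀ x₀) :
    ∃ z : ℝ → FieldCircuit.State ι F N L V,
      FieldCircuit.IsExactSolution fm ci t₀ T a₀ x₀ z ∧
      (∀ z' : ℝ → FieldCircuit.State ι F N L V,
        FieldCircuit.IsExactSolution fm ci t₀ T a₀ x₀ z' → EqOn z' z (Icc t₀ T)) ∧
      ∀ v₀ : ℝ → F → ℝ, ContinuousOn v₀ (Icc t₀ T) →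
        ∃ Z : ℕ → ℝ → FieldCircuit.State ι F N L V,
          FieldCircuit.IsWaveformRelaxation fm ci t₀ T a₀ x₀ v₀ Z ∧
          (∀ Z' : ℕ → ℝ → FieldCircuit.State ι F N L V,
            FieldCircuit.IsWaveformRelaxation fm ci t₀ T a₀ x₀ v₀ Z' →
              ∀ k : ℕ, EqOn (Z' k) (Z k) (Icc t₀ T)) ∧
          TendstoUniformlyOn Z z atTop (Icc t₀ T) := by
  open FieldCircuit in
  obtain ⟨f, H, χ, y₀, hf, hH, hχ, hχH, hfwd, hbwd⟩ :=
    exists_coupled_reduction hT hfm hXM hK hci hCVR h₀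
  have hid : TameOn (Icc t₀ T) (fun _ (y : DiffState ι F C L) => y) :=
    TameOn.clm (ContinuousLinearMap.id ℝ _)
  obtain ⟨y, hy, hrelax⟩ := exists_waveform_limit hT.le hf hH y₀
  have huniq : ∀ v z w, SolvesWithInput fm ci t₀ T a₀ x₀ v z →
      SolvesIVP (fun t y => f t (y, v t)) t₀ T y₀ w → EqOn z (fun t => χ t (w t)) (Icc t₀ T) := by
    intro v z w hz hw t ht
    obtain ⟨hv, w', hw', hzw⟩ := hfwd v z hz
    have htame := hf.comp (hid.prodMk (TameOn.of_continuousOn isCompact_Icc hv))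
    rw [hzw t ht, SolvesIVP.eqOn htame hw' hw ht]
  refine ⟨fun t => χ t (y t), ?_, fun z' hz' t ht => ?_, fun v₀ hv₀ => ?_⟩
  · have h := hbwd (fun t => H t (y t)) y (hH.continuousOn_comp hy.continuousOn) hy
    simpa only [IsExactSolution, hχH] using h
  · -- along `z'` the input is the output `H` of the differential variables of `z'`
    obtain ⟨hv, w, hw, hzw⟩ := hfwd _ z' hz'
    have hw' : SolvesIVP (fun t y => f t (y, H t y)) t₀ T y₀ w := by
      refine ⟨hw.1, fun t ht => ?_⟩
      have h := hw.2 t ht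
      simp only [hzw t ht, hχH] at h
      exact h
    rw [hzw t ht, SolvesIVP.eqOn (hf.comp (hid.prodMk hH)) hw' hy ht]
  · obtain ⟨Y, hY₀, hY, ⟨R, hR⟩, hlim⟩ := hrelax v₀ hv₀
    have hYc : ∀ k, ContinuousOn (Y k) (Icc t₀ T) := fun k => by
      cases k with
      | zero => exact hY₀.continuousOn
      | succ k => exact (hY k).continuousOn
    refine ⟨fun k t => χ t (Y k t), ⟨hbwd v₀ (Y 0) hv₀ hY₀, fun k => ?_⟩, fun Z' hZ' k => ?_,
      tendstoUniformlyOn_comp_of_continuousOn isCompact_Icc hχ hy.continuousOn hR hlim⟩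
    · have h := hbwd (fun t => H t (Y k t)) (Y (k + 1)) (hH.continuousOn_comp (hYc k)) (hY k)
      simpa only [hχH] using h
    · induction k with
      | zero => exact huniq _ _ _ hZ'.1 hY₀
      | succ k ih =>
        refine huniq _ _ _ (hZ'.2 k) ⟨(hY k).1, fun t ht => ?_⟩
        have h := (hY k).2 t ht
        simp only
        rw [ih ht]
        simp only [hχH]
        exact h
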